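/- Let $p\ge 3$ and $q$ be odd integers, put $a=p-1$, $b=q-1$, $g=\gcd(a,b)$, and assume $q\ge a^2-a+1$. Let $K=P(-p,p,q)$ be the pretzel knot with rational tangles $-\frac1p,\frac1p,\frac1q$, and consider the Hatcher--Oertel edgepath system for $K$ in the diagram $\mathcal D$ given by $$\gamma_0:\ \langle -\tfrac1p\rangle\to \tfrac{x_0}{s}\langle -\tfrac1p\rangle+\tfrac{y_0}{s}\langle -\tfrac1{p-1}\rangle,\qquad \gamma_1:\ \langle \tfrac1p\rangle\to \tfrac{x_1}{s}\langle \tfrac1p\rangle+\tfrac{y_1}{s}\langle \tfrac01\rangle,\qquad \gamma_2:\ \langle \tfrac1q\rangle\to \tfrac{x_2}{s}\langle \tfrac1q\rangle+\tfrac{y_2}{s}\langle \tfrac01\rangle,$$ with $x_0=\frac{a+b-a^2}{g}$, $y_0=\frac{a^2}{g}$, $x_1=y_2=\frac bg$, $y_1=x_2=\frac ag$, and $s=\frac{a+b}{g}$ sheets. A candidate surface $F$ of this system is obtained as follows. In the $i$-th tangle ball take $s$ parallel sheets along each of the two strands of the tangle, meeting a parallel copy of the boundary sphere in $s$ copies of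 each of the two arcs of the initial slope of $\gamma_i$, and attach $y_i$ saddles, each of which replaces a pair of arcs of the initial slope by a pair of arcs whose slope is that of the other vertex of the edge containing $\gamma_i$; every saddle may run over either of the two sides (front or back) of the four-punctured sphere. Then glue the surfaces in the three balls along their arcs in the discs in which the balls meet. If $g$ is even and $(a+b)/g$ is even, then, for every choice of the saddles, $F$ is an orientable compact surface: the pieces (sheets and saddles) are glued in pairs along the attaching arcs of the saddles and the arcs in the common discs, all their remaining sides lie on the boundary of the neighbourhood of $K$, and the pieces can be oriented so that the orientations match along all gluings. -/

import Mathlib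

/-! ### Polygonal surfaces -/

/-- A directed edge: a named edge of a cell complex together with a direction. -/
structure Dart (E V : Type) where
  name : E
  src : V
  tgt : V

/-- The same edge, traversed backwards. -/
def Dart.reverse {E V : Type} (d : Dart E V) : Dart E V := ⟨d.name, d.tgt, d.src⟩

/-- Two darts lie on the same edge. -/
def Dart.SameEdge {E V : Type} (d d' : Dart E V) : Prop := d' = d ∨ d' = d.reverse

/-- A finite family of polygonal discs (`Face`), given by their boundary words: `boundary f` lists
the directed edges met when the boundary circle of the polygon `f` is traversed once.  The space it
describes is obtained from the disjoint union of the polygons by gluing together all polygon sides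
that lie on the same edge. The edges whose name satisfies `Free` are meant to stay unglued. -/
structure PolygonalComplex where
  Face : Type
  Name : Type
  Vertex : Type
  finite : Finite Face
  boundary : Face → List (Dart Name Vertex)
  Free : Name → Prop

namespace PolygonalComplex

variable (F : PolygonalComplex)

/-- A side of a polygon: a face and a position in its boundary word. -/
def Side : Type := Σ f : F.Face, Fin (F.boundary f).length

/-- The directed edge along which a side runs. -/
def Side.dart {F : PolygonalComplex} (e : F.Side) : Dart F.Name F.Vertex :=
  (F.boundary e.1).get e.2

/-- The glued space is a compact surface with boundary: every edge is a side of exactly two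
polygons (counted with multiplicity), except that every free edge is a side of exactly one. The
boundary of the surface is then the union of the free edges. -/
def IsSurface : Prop :=
  ∀ e : F.Side,
    (¬ F.Free e.dart.name → {e' : F.Side | e.dart.SameEdge e'.dart}.ncard = 2) ∧
    (F.Free e.dart.name → {e' : F.Side | e.dart.SameEdge e'.dart}.ncard = 1)

/-- Orientability: the polygons can be oriented (`o f = 1` for the direction of the boundary word,
`o f = -1` for the opposite one) in such a way that any two different sides which are glued together
receive opposite directions. -/
def IsOrientable : Prop :=
  ∃ o : F.Face → ℤˣ, ∀ e e' : F.Side, e ≠ e' →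
    (e'.dart = e.dart → o e'.1 = - o e.1) ∧
    (e'.dart = e.dart.reverse → o e'.1 = o e.1)

end PolygonalComplex

/-! ### Edgepaths and edgepath systems -/

/-- An edgepath in the diagram `𝒟` that runs along (part of) one descending edge, from the vertex
`⟨p/q⟩` to the rational point `x/(x+y) ⟨p/q⟩ + y/(x+y) ⟨r/t⟩` of the edge `⟨p/q, r/t⟩`. -/
structure Edgepath where
  p : ℤ
  q : ℕ
  r : ℤ
  t : ℕ
  x : ℕ
  y : ℕ
  t_pos : 0 < t
  /-- The path runs from right to left. -/
  t_lt_q : t < q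
  /-- `p/q` and `r/t` span an edge of `𝒟`, and `r/t < p/q`. -/
  edge : p * t - r * q = 1

namespace Edgepath

variable (γ : Edgepath)

/-- The first of the three projective coordinates of the end point: the number of sheets. -/
def coordA : ℕ := γ.x + γ.y

/-- The second coordinate of the end point. -/
def coordB : ℕ := γ.x * (γ.q - 1) + γ.y * (γ.t - 1)

/-- The third coordinate of the end point. -/
def coordC : ℤ := γ.x * γ.p + γ.y * γ.r

end Edgepath

/-- A Montesinos link with three rational tangles, recorded by the slopes of the tangles. -/
abbrev MontesinosSlopes : Type := Fin 3 → ℚ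

/-- The pretzel link `P(k₀, k₁, k₂)`: its tangles are `1/k₀`, `1/k₁`, `1/k₂`. -/
def pretzel (k₀ k₁ k₂ : ℤ) : MontesinosSlopes := ![1 / (k₀ : ℚ), 1 / (k₁ : ℚ), 1 / (k₂ : ℚ)]

/-- An edgepath system with `s` sheets for the Montesinos link `K`, one (partial) edge per tangle:
the `i`-th path starts at the vertex of the `i`-th tangle; the end points (in coordinates
normalised to the common number `s` of sheets) lie on one vertical line of `𝒟`, and their vertical
coordinates `c / (s + b)` add up to zero. A path along a single edge is automatically minimal. -/
structure EdgepathSystem (K : MontesinosSlopes) where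
  path : Fin 3 → Edgepath
  s : ℕ
  b : ℕ
  s_pos : 0 < s
  start : ∀ i, ((path i).p : ℚ) / (path i).q = K i
  sheets : ∀ i, (path i).coordA = s
  horizontal : ∀ i, (path i).coordB = b
  vertical : ∑ i, (path i).coordC = 0

/-! ### Candidate surfaces

The sphere `S³` is the union of three balls `B₀, B₁, B₂` (one per tangle, in cyclic order) that
share a circle, the axis. The ball `B_i` meets `B_{i-1}` in its left wall, wall number `i`, and
`B_{i+1}` in its right wall, wall number `i + 1` (mod 3); the walls are discs bounded by the axis,
and each of them is crossed by the knot in two points.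

The four-punctured sphere `∂B_i` is the pillowcase `ℝ² / Γ`, where `Γ` is generated by the
half-turns about the points of `ℤ²`; the punctures are the images of `ℤ²`, an arc of slope `p/q` is
the image of a segment from a lattice point `v` to `v + (q, p)`, the axis is the image of the lines
`X ∈ 1/2 + ℤ`, and the left (right) wall is the image of the strips `|X - m| ≤ 1/2` with `m` even
(odd).

The curve system with coordinates `(s, b, c)` consists of `s` arc ends at every puncture. It is
realised by straight segments of slope `c / (s + b)`, once the puncture `(m, n)` has been stretched
to the vertical slit with centre `(m, n)` and length `s / (s + b)`: it consists of the pieces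
between the slits of the lines of height
`Y = (ℓ - (s - 1) / 2 + X c) / (s + b)`, `ℓ ∈ ℤ`. The line number `ℓ` ends on the slit `(m, n)`
exactly when `ℓ = n (s + b) - m c + k` with `0 ≤ k < s`; the `s` ends on a slit are thus numbered by
`k` from bottom to top. The half-turn about the origin takes the line `ℓ` to the line
`s - 1 - ℓ`, the translation by `(-m, 0)`, `m` even, takes it to the line `ℓ + m c`, and the
translation by `(0, 2)` takes it to the line `ℓ + 2 (s + b)`. Hence the points of the curve system on
the axis, a circle represented by the line `X = 1/2`, are numbered by `ℤ / 2 (s + b)`. -/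

namespace EdgepathSystem

variable {K : MontesinosSlopes} (S : EdgepathSystem K)

/-- The number of points in which the candidate surface meets the axis. -/
def axisCount : ℕ := 2 * (S.s + S.b)

/-- The walls of the `i`-th ball: the strip `|X - m| ≤ 1/2` lies over the left wall when `m` is even
and over the right wall when `m` is odd. -/
def wallOf (i : Fin 3) (m : ℕ) : Fin 3 := if Even m then i else i + 1

/-- The punctures on the left wall of the `i`-th ball have their arc ends at the axis points
`offset i + k` and `offset i + (s + b) + k`, `0 ≤ k < s`. On the right wall of the same ball the
arc ends are shifted by `-c_i`; since right wall `i` is left wall `i + 1`, the offsets add up (and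
close up after the last ball, because the `c_i` add up to zero). -/
def offset (i : Fin 3) : ℤ := - ∑ j ∈ Finset.univ.filter (· < i), (S.path j).coordC

/-- The axis point in which the line number `ℓ` on the pillowcase of the `i`-th ball crosses the
vertical line `X = m + 1/2`. -/
def axisPoint (i : Fin 3) (ℓ : ℤ) (m : ℕ) : ZMod S.axisCount :=
  if Even m then ((ℓ + m * (S.path i).coordC + S.offset i : ℤ) : ZMod S.axisCount)
  else (((S.s : ℤ) - 1 - (ℓ + (m + 1) * (S.path i).coordC) + S.offset i : ℤ) : ZMod S.axisCount)

/-- The two families of `s` parallel sheets in a ball: the copies of the arc `α` that joins `(0, 0)`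
to `(q, p)`, and the copies of the arc `β` that joins `(t, r)` to `(q + t, p + r)`. -/
inductive Family where
  | alpha
  | beta

/-- The vertices of the cell structure of a candidate surface. -/
inductive Vertex (N : ℕ) where
  /-- A point on the axis. -/
  | axis (l : ZMod N)
  /-- The point on the boundary of the neighbourhood of the knot at which the arc of the wall `w`
  that leaves the axis at the point `l` ends. -/
  | knot (w : Fin 3) (l : ZMod N)
  /-- The initial (`false`) and final (`true`) point of the arc, inside the ball `i`, along which the
  `j`-th sheet of a family is attached to a saddle. -/
  | inner (i : Fin 3) (f : Family) (j : ℕ) (final : Bool)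

/-- The kinds of edges of a candidate surface: arcs in the wall `w`, arcs inside the ball `i` along
which a saddle is attached to a sheet, and arcs in the ball `i` on the boundary of the neighbourhood
of the knot. Edges of the same kind are distinguished by their end points. -/
inductive EdgeName where
  | wall (w : Fin 3)
  | seam (i : Fin 3)
  | rim (i : Fin 3)

/-- The darts of the candidate surface. -/
abbrev SDart : Type := Dart EdgeName (Vertex S.axisCount)

/-- The arc on the boundary of the `i`-th ball that starts at a puncture `(m, n)`, runs along the line
number `ℓ` to the right, crosses the axis `len` times, and ends at a puncture `(m + len, n')`; it is
cut by the axis into `len + 1` pieces, one in each of the strips `m, m + 1, …, m + len`. -/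
def arc (i : Fin 3) (m : ℕ) (ℓ : ℤ) (len : ℕ) : List S.SDart :=
  (List.range (len + 1)).map fun k =>
    { name := .wall (wallOf i (m + k))
      src := if k = 0 then .knot (wallOf i m) (S.axisPoint i ℓ m)
        else .axis (S.axisPoint i ℓ (m + k - 1))
      tgt := if k = len then .knot (wallOf i (m + len)) (S.axisPoint i ℓ (m + len - 1))
        else .axis (S.axisPoint i ℓ (m + k)) }

/-- The first vertex of `arc i m ℓ len`. -/
def arcStart (i : Fin 3) (m : ℕ) (ℓ : ℤ) : Vertex S.axisCount :=
  .knot (wallOf i m) (S.axisPoint i ℓ m)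

/-- The last vertex of `arc i m ℓ len`. -/
def arcEnd (i : Fin 3) (m : ℕ) (ℓ : ℤ) (len : ℕ) : Vertex S.axisCount :=
  .knot (wallOf i (m + len)) (S.axisPoint i ℓ (m + len - 1))

/-- The lowest line that ends on the slit at the puncture `(m, n)` of the `i`-th ball. -/
def slitBase (i : Fin 3) (m : ℕ) (n : ℤ) : ℤ := n * (S.s + S.b) - m * (S.path i).coordC

/-! The front face of the pillowcase is the parallelogram with vertices `(0, 0)`, `(t, r)`,
`(q + t, p + r)`, `(q, p)`; its left, right, bottom and top sides are the arcs `α` and `β` of slope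
`p/q` and two arcs of slope `r/t`. At every puncture, among the ends that leave to the right, those of
slope `r/t` are the lowest `y` ones and those of slope `p/q` are the highest `x` ones. In each of the
four families of parallel arcs in the final curve system, the copies are counted from front to back. -/

/-- The number of the first column and of the line of the `k`-th final copy of `α` or `β`. -/
def sideArc (i : Fin 3) : Family → ℕ → ℕ × ℤ
  | .alpha, k => (0, (S.path i).y + k)
  | .beta, k => ((S.path i).t, S.slitBase i (S.path i).t (S.path i).r + S.s - 1 - k)

/-- The number of the line of the `k`-th final copy of the bottom arc, which starts at `(0, 0)`. -/
def bottomLine (i : Fin 3) (k : ℕ) : ℤ := (S.path i).y - 1 - k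

/-- The number of the line of the `k`-th final copy of the top arc, which starts at `(q, p)`. -/
def topLine (i : Fin 3) (k : ℕ) : ℤ := S.slitBase i (S.path i).q (S.path i).p + k

/-- A choice of saddles. A saddle that turns a copy of `α` and a copy of `β` into a bottom arc and a
top arc runs over the front or over the back of the pillowcase. In the `i`-th ball, `front i` of the
`y` saddles run over the front, the remaining ones over the back. -/
def SaddleChoice : Type := ∀ i : Fin 3, Fin ((S.path i).y + 1)

/-- The sheets of both families are numbered `0, …, s - 1` from front to back. The successive front
saddles are attached to the sheets `0, 1, …, front - 1` and the successive back saddles to the sheets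
`s - 1, s - 2, …`. The `k`-th saddle is the one that produces the `k`-th final copies of the top and
of the bottom arc; this is the sheet (of each of the two families) to which it is attached. -/
def saddleSheet (front : S.SaddleChoice) (i : Fin 3) (k : ℕ) : ℕ :=
  if k < front i then front i - 1 - k else S.s - 1 - (k - front i)

/-- The attaching arc of the `j`-th sheet of a family. -/
def seam (i : Fin 3) (f : Family) (j : ℕ) : S.SDart := ⟨.seam i, .inner i f j false, .inner i f j true⟩

/-- An arc on the boundary of the neighbourhood of the knot. -/
def rim (i : Fin 3) (u v : Vertex S.axisCount) : S.SDart := ⟨.rim i, u, v⟩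

/-- The polygons of a candidate surface: in the `i`-th ball, the `2 s` sheets and the `y` saddles. -/
inductive Face where
  | sheet (i : Fin 3) (f : Family) (j : Fin S.s)
  | saddle (i : Fin 3) (k : Fin (S.path i).y)

/-- The boundary word of the `j`-th sheet of a family in the `i`-th ball. A sheet is a product of an
arc with an interval; one of its four sides is an arc of a curve system and the other three form an
arc on the boundary of the neighbourhood of the knot. The sheets to which no saddle is attached extend
to the boundary of the ball. -/
def sheetWord (front : S.SaddleChoice) (i : Fin 3) (f : Family) (j : ℕ) : List S.SDart :=
  if (front i : ℕ) ≤ j ∧ j < front i + (S.path i).x then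
    let a := S.sideArc i f (j - front i)
    S.arc i a.1 a.2 (S.path i).q ++
      [S.rim i (S.arcEnd i a.1 a.2 (S.path i).q) (S.arcStart i a.1 a.2)]
  else
    [S.seam i f j, S.rim i (.inner i f j true) (.inner i f j false)]

/-- The boundary word of the `k`-th saddle in the `i`-th ball (extended to the boundary of the ball):
up along a copy of `α`, to the right along a top arc, down along a copy of `β`, and to the left along a
bottom arc, with arcs on the boundary of the neighbourhood of the knot in between. -/
def saddleWord (front : S.SaddleChoice) (i : Fin 3) (k : ℕ) : List S.SDart :=
  let j := S.saddleSheet front i k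
  let q := (S.path i).q
  let t := (S.path i).t
  [S.seam i .alpha j,
    S.rim i (.inner i .alpha j true) (S.arcStart i q (S.topLine i k))] ++
  S.arc i q (S.topLine i k) t ++
  [S.rim i (S.arcEnd i q (S.topLine i k) t) (.inner i .beta j true),
    (S.seam i .beta j).reverse,
    S.rim i (.inner i .beta j false) (S.arcEnd i 0 (S.bottomLine i k) t)] ++
  ((S.arc i 0 (S.bottomLine i k) t).map Dart.reverse).reverse ++
  [S.rim i (S.arcStart i 0 (S.bottomLine i k)) (.inner i .alpha j false)]

/-- The boundary words of all polygons. -/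
def faceWord (front : S.SaddleChoice) : S.Face → List S.SDart
  | .sheet i f j => S.sheetWord front i f j
  | .saddle i k => S.saddleWord front i k

/-- There are finitely many polygons. -/
theorem finite_face : Finite S.Face := by
  have : Finite Family := Finite.of_injective
    (fun f : Family => (match f with | .alpha => true | .beta => false : Bool))
    (by rintro (_ | _) (_ | _) h <;> simp_all)
  refine Finite.of_injective
    (β := (Fin 3 × Family × Fin S.s) ⊕ (Σ i : Fin 3, Fin (S.path i).y))
    (fun F => match F with
      | .sheet i f j => Sum.inl (i, f, j)
      | .saddle i k => Sum.inr ⟨i, k⟩) ?_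
  rintro (⟨i, f, j⟩ | ⟨i, k⟩) (⟨i', f', j'⟩ | ⟨i', k'⟩) h <;> simp_all

/-- The candidate surface of an edgepath system with one edge per tangle, with `s` sheets and with the
given choice of saddles. It lies in the exterior of the link `K`; its free edges are those on the
boundary of the neighbourhood of the link. The surfaces inside the three balls are glued along the
arcs in the walls. -/
def candidateSurface (front : S.SaddleChoice) : PolygonalComplex where
  Face := S.Face
  Name := EdgeName
  Vertex := Vertex S.axisCount
  finite := S.finite_face
  boundary := S.faceWord front
  Free e := ∃ i, e = .rim i

end EdgepathSystem

/-! ### The edgepath system for the pretzel knot `P(-p, p, q)` -/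

/-- The weights below are integers and satisfy the equations required of an edgepath system. -/
theorem pretzel_weights (p q : ℕ) (hp : 3 ≤ p) (hq : (p - 1) ^ 2 - (p - 1) + 1 ≤ q) :
    3 ≤ q ∧ ∃ g a b x : ℕ, p - 1 = g * a ∧ q - 1 = g * b ∧
      (p - 1) / Nat.gcd (p - 1) (q - 1) = a ∧ (q - 1) / Nat.gcd (p - 1) (q - 1) = b ∧
      ((p - 1) + (q - 1) - (p - 1) ^ 2) / Nat.gcd (p - 1) (q - 1) = x ∧
      (p - 1) ^ 2 / Nat.gcd (p - 1) (q - 1) = g * a ^ 2 ∧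
      ((p - 1) + (q - 1)) / Nat.gcd (p - 1) (q - 1) = a + b ∧
      (p - 1) * (q - 1) / Nat.gcd (p - 1) (q - 1) = g * a * b ∧
      x + g * a ^ 2 = a + b := by
  have hq3 : 3 ≤ q := by
    obtain ⟨a, rfl⟩ : ∃ a, p = a + 3 := ⟨p - 3, by omega⟩
    have h1 : a + 3 - 1 = a + 2 := by omega
    rw [h1] at hq
    have h2 : (a + 2) ^ 2 = (a ^ 2 + 3 * a + 2) + (a + 2) := by ring
    rw [h2, Nat.add_sub_cancel] at hq
    nlinarith
  refine ⟨hq3, ?_⟩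
  obtain ⟨a, ha⟩ := Nat.gcd_dvd_left (p - 1) (q - 1)
  obtain ⟨b, hb⟩ := Nat.gcd_dvd_right (p - 1) (q - 1)
  have hg : 0 < Nat.gcd (p - 1) (q - 1) := Nat.gcd_pos_of_pos_left _ (by omega)
  generalize Nat.gcd (p - 1) (q - 1) = g at *
  have hsq : (p - 1) ^ 2 = g * (g * a ^ 2) := by rw [ha]; ring
  have hle : g * (g * a ^ 2) ≤ g * (a + b) := by
    rw [← hsq, mul_add, ← ha, ← hb]; omega
  have hle' := Nat.le_of_mul_le_mul_left hle hg
  refine ⟨g, a, b, a + b - g * a ^ 2, ha, hb, ?_, ?_, ?_, ?_, ?_, ?_, by omega⟩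
  · rw [ha, Nat.mul_div_cancel_left _ hg]
  · rw [hb, Nat.mul_div_cancel_left _ hg]
  · rw [hsq, ha, hb, ← mul_add, ← Nat.mul_sub, Nat.mul_div_cancel_left _ hg]
  · rw [hsq, Nat.mul_div_cancel_left _ hg]
  · rw [ha, hb, ← mul_add, Nat.mul_div_cancel_left _ hg]
  · rw [ha, hb, show g * a * (g * b) = g * (g * a * b) by ring, Nat.mul_div_cancel_left _ hg]

/-- The edgepath from `⟨-1/p⟩` towards `⟨-1/(p-1)⟩`. -/
def pretzelPath₀ (p : ℕ) (hp : 3 ≤ p) (x y : ℕ) : Edgepath where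
  p := -1
  q := p
  r := -1
  t := p - 1
  x := x
  y := y
  t_pos := by omega
  t_lt_q := by omega
  edge := by push_cast [show 1 ≤ p by omega]; ring

/-- The edgepath from `⟨1/p⟩` towards `⟨0/1⟩`. -/
def pretzelPath₁ (p : ℕ) (hp : 3 ≤ p) (x y : ℕ) : Edgepath where
  p := 1
  q := p
  r := 0
  t := 1
  x := x
  y := y
  t_pos := by omega
  t_lt_q := by omega
  edge := by simp

/-- The edgepath system for `P(-p, p, q)`, with `a = p - 1`, `b = q - 1` and `g = gcd(a, b)`:
the paths run from `⟨-1/p⟩` towards `⟨-1/(p-1)⟩`, from `⟨1/p⟩` towards `⟨0/1⟩` and from `⟨1/q⟩`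
towards `⟨0/1⟩`, with weights `(x₀, y₀) = ((a + b - a²)/g, a²/g)`, `(x₁, y₁) = (b/g, a/g)` and
`(x₂, y₂) = (a/g, b/g)`; there are `(a + b)/g` sheets. -/
def pretzelSystem (p q : ℕ) (hp : 3 ≤ p) (hq : (p - 1) ^ 2 - (p - 1) + 1 ≤ q) :
    EdgepathSystem (pretzel (-p) p q) where
  path := ![
    pretzelPath₀ p hp (((p - 1) + (q - 1) - (p - 1) ^ 2) / Nat.gcd (p - 1) (q - 1))
      ((p - 1) ^ 2 / Nat.gcd (p - 1) (q - 1)),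
    pretzelPath₁ p hp ((q - 1) / Nat.gcd (p - 1) (q - 1)) ((p - 1) / Nat.gcd (p - 1) (q - 1)),
    pretzelPath₁ q (pretzel_weights p q hp hq).1
      ((p - 1) / Nat.gcd (p - 1) (q - 1)) ((q - 1) / Nat.gcd (p - 1) (q - 1))]
  s := ((p - 1) + (q - 1)) / Nat.gcd (p - 1) (q - 1)
  b := (p - 1) * (q - 1) / Nat.gcd (p - 1) (q - 1)
  s_pos := Nat.div_pos
    ((Nat.gcd_le_left _ (by omega)).trans (by omega)) (Nat.gcd_pos_of_pos_left _ (by omega))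
  start := by
    intro i
    fin_cases i <;> simp [pretzel, pretzelPath₀, pretzelPath₁, neg_div, div_neg]
  sheets := by
    obtain ⟨-, g, a, b, x, ha, hb, h1, h2, h3, h4, h5, h6, hs⟩ := pretzel_weights p q hp hq
    simp only [h1, h2, h3, h4, h5]
    intro i
    fin_cases i
    · exact hs
    · exact add_comm b a
    · rfl
  horizontal := by
    obtain ⟨-, g, a, b, x, ha, hb, h1, h2, h3, h4, h5, h6, hs⟩ := pretzel_weights p q hp hq
    simp only [h1, h2, h3, h4, h6]
    intro i
    fin_cases i
    · change x * (p - 1) + g * a ^ 2 * (p - 1 - 1) = g * a * b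
      have h7 : 1 ≤ g * a := by omega
      rw [ha]
      zify [h7]
      have : (x : ℤ) + g * a ^ 2 = a + b := by exact_mod_cast hs
      linear_combination (g * a : ℤ) * this
    · change b * (p - 1) + a * (1 - 1) = g * a * b
      rw [ha]; simp; ring
    · change a * (q - 1) + b * (1 - 1) = g * a * b
      rw [hb]; simp; ring
  vertical := by
    obtain ⟨-, g, a, b, x, ha, hb, h1, h2, h3, h4, h5, h6, hs⟩ := pretzel_weights p q hp hq
    simp only [h1, h2, h3, h4]
    rw [Fin.sum_univ_three]
    change ((x : ℤ) * (-1) + ((g * a ^ 2 : ℕ) : ℤ) * (-1)) + ((b : ℤ) * 1 + (a : ℤ) * 0)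
      + ((a : ℤ) * 1 + (b : ℤ) * 0) = 0
    have : (x : ℤ) + g * a ^ 2 = a + b := by exact_mod_cast hs
    push_cast
    linear_combination -this

/-!
The statement holds for every edgepath system with one edge per tangle: a candidate surface is always
a surface (`candidateSurface_isSurface`), and it is orientable as soon as the number `s` of sheets is
even (`candidateSurface_isOrientable`).

**Surface.** In a ball with boundary slope `p/q` and other slope `r/t`, the free sheets and the saddles
meet the boundary sphere in `2 x` arcs of slope `p/q` and `2 y` arcs of slope `r/t`. They are numbered
here by pairs `(ε, κ)` with `ε < 2` and `κ < s`, where `κ` is the position of the end of the arc in its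
slit: the arcs with `κ < y` are those of slope `r/t`. Two arcs that meet the axis in the same point
either differ by a translation, by an even lattice vector, or by a half-turn about a lattice point.
Writing lattice vectors in the basis `(q, p)`, `(t, r)`, where the numbers of the lines are
`u y - v x + κ`, an elementary estimate (`eq_zero_of_arcs_meet`) shows that the two arcs start at the
same puncture in the same position; the choice of the starting points then excludes the half-turn and
makes the arcs equal (`ray_injective`). The arcs meet the axis `2 (x q + y t) = 2 (s + b)` times, which
is the number of all points on the axis, so every point is met exactly once (`ray_surjective`). The
same estimate shows that the arcs do not run into a slit between their end points (`ray_onSlit_iff`).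
Therefore every piece of an arc is the arc `wallDart w l` of the wall `w` that starts at an axis
point `l`, up to direction, and this depends on the wall only. Each of the two balls at a wall thus
contributes exactly one side to each arc of the wall. Every seam is a side of one sheet and one
saddle, and the edges on the boundary of the neighbourhood of the knot have one side each.

**Orientation.** The half-turn about a puncture takes the axis point `l` to `s - 1 - l`, up to an even
number. If `s` is even, then the two ends of every arc that returns to the axis have opposite
parities. Hence the arcs in the walls can be directed by the sign `(-1) ^ l` of their end points on
the axis, so that a face in one of the adjacent balls always runs along them in the given direction
and a face in the other ball runs against it. A sheet or a saddle that contains the line number `ℓ` is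
oriented by the parity of `ℓ`; the bottom and the top arc of a saddle agree, because the sum of their
numbers is `2 y - 1`, so that their parities differ, and the saddle runs along them in opposite
directions. A sheet to which a saddle is attached meets no wall and is oriented by its
saddle.
-/

/-! ### Counting the sides of a polygonal complex -/

open Classical in
/-- The number of entries of a word that satisfy a given property. -/
noncomputable def wordCount {δ : Type*} (P : δ → Prop) (l : List δ) : ℕ :=
  l.countP fun d => decide (P d)

section wordCount

variable {δ : Type*} (P : δ → Prop)

theorem wordCount_nil : wordCount P [] = 0 := by simp [wordCount]

open Classical in
theorem wordCount_cons (d : δ) (l : List δ) :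
    wordCount P (d :: l) = wordCount P l + if P d then 1 else 0 := by
  simp [wordCount, List.countP_cons]

theorem wordCount_append (l l' : List δ) :
    wordCount P (l ++ l') = wordCount P l + wordCount P l' := by
  simp [wordCount]

theorem wordCount_reverse (l : List δ) : wordCount P l.reverse = wordCount P l := by
  simp [wordCount]

theorem wordCount_map {γ : Type*} (g : γ → δ) (l : List γ) :
    wordCount P (l.map g) = wordCount (fun c => P (g c)) l := by
  simp [wordCount, List.countP_map, Function.comp_def]

variable {P}

theorem wordCount_eq_zero {l : List δ} (h : ∀ d ∈ l, ¬ P d) : wordCount P l = 0 := by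
  simpa [wordCount, List.countP_eq_zero] using h

theorem wordCount_congr {Q : δ → Prop} {l : List δ} (h : ∀ d ∈ l, P d ↔ Q d) :
    wordCount P l = wordCount Q l := by
  refine List.countP_congr fun d hd => ?_
  simpa using h d hd

theorem wordCount_and_left {a : Prop} (ha : a) (l : List δ) :
    wordCount (fun d => a ∧ P d) l = wordCount P l :=
  wordCount_congr fun _ _ => and_iff_right ha

open Classical in
theorem wordCount_map_range (g : ℕ → δ) (n : ℕ) :
    wordCount P ((List.range n).map g) = ∑ k ∈ Finset.range n, if P (g k) then 1 else 0 := by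
  induction n with
  | zero => simp [wordCount_nil]
  | succ n ih =>
    rw [List.range_succ, List.map_append, wordCount_append, ih, Finset.sum_range_succ]
    simp [wordCount_cons, wordCount_nil]

open Classical in
theorem wordCount_eq_card_filter (l : List δ) :
    wordCount P l = (Finset.univ.filter fun k : Fin l.length => P (l.get k)).card := by
  rw [Finset.card_filter]
  induction l with
  | nil => simp [wordCount_nil]
  | cons d l ih =>
    rw [wordCount_cons, ih, add_comm]
    exact (Fin.sum_univ_succ (n := l.length) fun k =>
      if P ((d :: l).get k) then (1 : ℕ) else 0).symm

open Classical in
/-- If the entries with a given property occur only once in a finite family of words, then there is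
exactly one position at which such an entry occurs. -/
theorem existsUnique_position {Φ : Type*} [Fintype Φ] (W : Φ → List δ) (Q : Φ → δ → Prop)
    (h : ∑ f, wordCount (Q f) (W f) = 1) :
    ∃! e : Σ f, Fin (W f).length, Q e.1 ((W e.1).get e.2) := by
  have h1 : (Finset.univ.filter
      fun e : Σ f, Fin (W f).length => Q e.1 ((W e.1).get e.2)).card = 1 := by
    rw [← h, Finset.card_filter, Fintype.sum_sigma]
    refine Finset.sum_congr rfl fun f _ => ?_
    rw [wordCount_eq_card_filter, Finset.card_filter]
  obtain ⟨e, he⟩ := Finset.card_eq_one.1 h1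
  have h2 : ∀ e', Q e'.1 ((W e'.1).get e'.2) ↔ e' = e := fun e' => by
    simpa using congrArg (e' ∈ ·) he
  exact ⟨e, (h2 e).2 rfl, fun e' h' => (h2 e').1 h'⟩

end wordCount

theorem Dart.reverse_reverse {E V : Type} (d : Dart E V) : d.reverse.reverse = d := rfl

theorem Dart.sameEdge_reverse_left {E V : Type} (d d' : Dart E V) :
    d.reverse.SameEdge d' ↔ d.SameEdge d' := by
  unfold Dart.SameEdge
  rw [Dart.reverse_reverse]
  exact or_comm

theorem Dart.sameEdge_reverse_right {E V : Type} (d d' : Dart E V) :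
    d.SameEdge d'.reverse ↔ d.SameEdge d' := by
  obtain ⟨n, u, v⟩ := d
  obtain ⟨n', u', v'⟩ := d'
  simp only [Dart.SameEdge, Dart.reverse, Dart.mk.injEq]
  tauto

namespace PolygonalComplex

variable {F : PolygonalComplex}

/-- A criterion for surfaces: the faces along every glued edge fall into two classes, and each
class contributes exactly one side. -/
theorem isSurface_of_classes (cls : F.Face → F.Name → Bool)
    (h : ∀ e : F.Side, ¬ F.Free e.dart.name → ∀ b : Bool,
      ∃! e' : F.Side, cls e'.1 e.dart.name = b ∧ e.dart.SameEdge e'.dart)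
    (hfree : ∀ e : F.Side, F.Free e.dart.name → ∃! e' : F.Side, e.dart.SameEdge e'.dart) :
    F.IsSurface := by
  refine fun e => ⟨fun hn => ?_, fun hf => ?_⟩
  · obtain ⟨e₁, h₁, u₁⟩ := h e hn true
    obtain ⟨e₂, h₂, u₂⟩ := h e hn false
    rw [Set.ncard_eq_two]
    refine ⟨e₁, e₂, ?_, ?_⟩
    · rintro rfl
      exact absurd (h₁.1.symm.trans h₂.1) (by decide)
    · ext e'
      constructor
      · intro he'
        cases hc : cls e'.1 e.dart.name
        · exact Or.inr (u₂ e' ⟨hc, he'⟩)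
        · exact Or.inl (u₁ e' ⟨hc, he'⟩)
      · rintro (rfl | rfl)
        exacts [h₁.2, h₂.2]
  · obtain ⟨e₁, h₁, u₁⟩ := hfree e hf
    rw [Set.ncard_eq_one]
    exact ⟨e₁, Set.ext fun e' => ⟨fun he' => u₁ e' he', fun he' => he' ▸ h₁⟩⟩

/-- A criterion for orientability: the glued edges carry directions `φ` such that the faces of one
class run along them in the direction that `φ` prescribes, and those of the other class in the
opposite direction. -/
theorem isOrientable_of_classes (cls : F.Face → F.Name → Bool)
    (h : ∀ e : F.Side, ¬ F.Free e.dart.name → ∀ b : Bool,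
      ∃! e' : F.Side, cls e'.1 e.dart.name = b ∧ e.dart.SameEdge e'.dart)
    (hfree : ∀ e : F.Side, F.Free e.dart.name → ∃! e' : F.Side, e.dart.SameEdge e'.dart)
    (o : F.Face → ℤˣ) (φ : Dart F.Name F.Vertex → ℤˣ)
    (hφ : ∀ e : F.Side, ¬ F.Free e.dart.name → φ e.dart.reverse = - φ e.dart)
    (ho : ∀ e : F.Side, ¬ F.Free e.dart.name →
      o e.1 = if cls e.1 e.dart.name then φ e.dart else - φ e.dart) :
    F.IsOrientable := by
  refine ⟨o, fun e e' hne => ?_⟩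
  by_cases hf : F.Free e.dart.name
  · obtain ⟨e₁, -, u₁⟩ := hfree e hf
    have he := u₁ e (Or.inl rfl)
    exact ⟨fun h' => absurd (he.trans (u₁ e' (Or.inl h')).symm) hne,
      fun h' => absurd (he.trans (u₁ e' (Or.inr h')).symm) hne⟩
  · have hcls : e.dart.SameEdge e'.dart → cls e'.1 e.dart.name = ! cls e.1 e.dart.name := by
      intro hs
      by_contra hc
      have hc' : cls e'.1 e.dart.name = cls e.1 e.dart.name := by
        revert hc; cases cls e'.1 e.dart.name <;> cases cls e.1 e.dart.name <;> simp
      obtain ⟨e₁, -, u₁⟩ := h e hf (cls e.1 e.dart.name)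
      exact hne ((u₁ e ⟨rfl, Or.inl rfl⟩).trans (u₁ e' ⟨hc', hs⟩).symm)
    have hname : ∀ d d' : Dart F.Name F.Vertex, d.SameEdge d' → d'.name = d.name := by
      rintro d d' (rfl | rfl) <;> rfl
    have key : e.dart.SameEdge e'.dart →
        o e'.1 = if cls e.1 e.dart.name then - φ e'.dart else φ e'.dart := by
      intro hs
      rw [ho e' (by rw [hname _ _ hs]; exact hf), hname _ _ hs, hcls hs]
      cases cls e.1 e.dart.name <;> simp
    refine ⟨fun h' => ?_, fun h' => ?_⟩
    · rw [key (Or.inl h'), ho e hf, h']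
      split_ifs <;> simp
    · rw [key (Or.inr h'), ho e hf, h', hφ e hf]
      split_ifs <;> simp

end PolygonalComplex

/-! ### Disjointness of the final arcs -/

/-- The final arcs that leave a puncture to the right are numbered by `κ < x + y`; the lowest `y` of
them are short (length `t`) and the other ones are long (length `q`). If two arcs, the second one
starting at the puncture that differs from the first one by `U (q, p) + V (t, r)`, meet in the same
point, then they are equal. -/
theorem eq_zero_of_arcs_meet {q t x y κ κ' k k' U V : ℤ} (ht : 0 < t) (htq : t < q)
    (hx : 0 ≤ x) (hy : 0 ≤ y) (hκ : 0 ≤ κ) (hκs : κ < x + y) (hκ' : 0 ≤ κ') (hκs' : κ' < x + y)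
    (hk : 0 ≤ k) (hkl : k < if κ < y then t else q)
    (hk' : 0 ≤ k') (hkl' : k' < if κ' < y then t else q)
    (h : κ' - κ = U * y - V * x) (h' : k' - k = U * q + V * t) : U = 0 ∧ V = 0 := by
  have key : ∀ {κ κ' k k' U V : ℤ}, 0 ≤ κ → κ < x + y → 0 ≤ κ' → κ' < x + y → 0 ≤ k →
      (k' < if κ' < y then t else q) → κ' - κ = U * y - V * x → k' - k = U * q + V * t →
      ¬ (1 ≤ U) ∧ (U = 0 → ¬ 1 ≤ V) := by
    intro κ κ' k k' U V hκ hκs hκ' hκs' hk hkl' h h'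
    refine ⟨fun hU => ?_, fun hU hV => ?_⟩
    · have hq : k' < q := by split_ifs at hkl' <;> omega
      rcases le_or_gt 0 V with hV | hV
      · nlinarith
      · nlinarith
    · subst hU
      split_ifs at hkl' with hc
      · nlinarith
      · nlinarith
  have h1 := key hκ hκs hκ' hκs' hk hkl' h h'
  have h2 := key (U := -U) (V := -V) hκ' hκs' hκ hκs hk' hkl (by linarith) (by linarith)
  have hU : U = 0 := by omega
  exact ⟨hU, by have := h1.2 hU; have := h2.2 (by omega); omega⟩

namespace EdgepathSystem

variable {K : MontesinosSlopes} (S : EdgepathSystem K) (i : Fin 3)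

/-! ### The final curve system in a ball -/

theorem x_add_y : (S.path i).x + (S.path i).y = S.s := S.sheets i

theorem q_pos : 0 < (S.path i).q := (S.path i).t_pos.trans (S.path i).t_lt_q

theorem s_add_b : S.s + S.b = (S.path i).x * (S.path i).q + (S.path i).y * (S.path i).t := by
  have h1 := S.x_add_y i
  have h2 : (S.path i).x * ((S.path i).q - 1) + (S.path i).y * ((S.path i).t - 1) = S.b :=
    S.horizontal i
  have hq := S.q_pos i
  have ht := (S.path i).t_pos
  obtain ⟨q, hq'⟩ : ∃ q, (S.path i).q = q + 1 := ⟨(S.path i).q - 1, by omega⟩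
  obtain ⟨t, ht'⟩ : ∃ t, (S.path i).t = t + 1 := ⟨(S.path i).t - 1, by omega⟩
  rw [hq', ht'] at h2 ⊢
  rw [← h1, ← h2]
  simp only [Nat.add_sub_cancel]
  ring

theorem s_add_b_cast : (S.s : ℤ) + S.b =
    (S.path i).x * (S.path i).q + (S.path i).y * (S.path i).t := by
  exact_mod_cast S.s_add_b i

theorem slitBase_q : S.slitBase i (S.path i).q (S.path i).p = (S.path i).y := by
  have h := (S.path i).edge
  rw [slitBase, S.s_add_b_cast i, Edgepath.coordC]
  linear_combination ((S.path i).y : ℤ) * h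

theorem slitBase_t : S.slitBase i (S.path i).t (S.path i).r = - (S.path i).x := by
  have h := (S.path i).edge
  rw [slitBase, S.s_add_b_cast i, Edgepath.coordC]
  linear_combination - ((S.path i).x : ℤ) * h

/-- The number of times the `κ`-th arc to the right of a puncture crosses the axis: the lowest `y`
arcs have slope `r/t` and the other ones have slope `p/q`. -/
def rayLen (κ : ℕ) : ℕ := if κ < (S.path i).y then (S.path i).t else (S.path i).q

/-- The column in which the final arc `(ε, κ)` of the `i`-th ball starts, where `ε < 2` and `κ < s`.
The arcs of slope `r/t` start at `(0, 0)` or `(q, p)`, those of slope `p/q` at `(0, 0)` or `(t, r)`,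
according as `ε` is `0` or `1`; the number `κ` is the position of the end in its slit. -/
def rayCol (ε κ : ℕ) : ℕ := ε * if κ < (S.path i).y then (S.path i).q else (S.path i).t

/-- The number of the line that contains the final arc `(ε, κ)`. -/
def rayLine (ε κ : ℕ) : ℤ := ε * (if κ < (S.path i).y then ((S.path i).y : ℤ) else - (S.path i).x) + κ

theorem rayLen_pos (κ : ℕ) : 0 < S.rayLen i κ := by
  unfold rayLen
  split_ifs
  exacts [(S.path i).t_pos, S.q_pos i]

variable {i} in
theorem axisPoint_even {m : ℕ} (hm : Even m) (ℓ : ℤ) : S.axisPoint i ℓ m =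
    ((ℓ + m * (S.path i).coordC + S.offset i : ℤ) : ZMod S.axisCount) := by
  rw [axisPoint, if_pos hm]

variable {i} in
theorem axisPoint_odd {m : ℕ} (hm : ¬ Even m) (ℓ : ℤ) : S.axisPoint i ℓ m =
    (((S.s : ℤ) - 1 - (ℓ + (m + 1) * (S.path i).coordC) + S.offset i : ℤ) : ZMod S.axisCount) := by
  rw [axisPoint, if_neg hm]

/-- Two points of the pillowcase on the axis agree only if the translation by an even lattice vector
or a half-turn about a lattice point takes one to the other. -/
theorem axisPoint_eq {i : Fin 3} {ℓ ℓ' : ℤ} {m m' : ℕ}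
    (h : S.axisPoint i ℓ m = S.axisPoint i ℓ' m') :
    (∃ d z : ℤ, (m : ℤ) - m' = 2 * d ∧
      ℓ = ℓ' - 2 * d * (S.path i).coordC + 2 * z * (S.s + S.b)) ∨
    (∃ d z : ℤ, (m : ℤ) + m' + 1 = 2 * d ∧
      ℓ = S.s - 1 - ℓ' - 2 * d * (S.path i).coordC + 2 * z * (S.s + S.b)) := by
  rcases Nat.even_or_odd m with hm | hm <;> rcases Nat.even_or_odd m' with hm' | hm'
  · rw [S.axisPoint_even hm, S.axisPoint_even hm', ZMod.intCast_eq_intCast_iff_dvd_sub] at h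
    obtain ⟨z, hz⟩ := h
    obtain ⟨a, ha⟩ := hm
    obtain ⟨a', ha'⟩ := hm'
    refine Or.inl ⟨a - a', -z, by push_cast [ha, ha']; ring, ?_⟩
    simp only [axisCount, ha, ha'] at hz
    push_cast at hz
    linear_combination -hz
  · rw [S.axisPoint_even hm, S.axisPoint_odd (Nat.not_even_iff_odd.2 hm'),
      ZMod.intCast_eq_intCast_iff_dvd_sub] at h
    obtain ⟨z, hz⟩ := h
    obtain ⟨a, ha⟩ := hm
    obtain ⟨a', ha'⟩ := hm'
    refine Or.inr ⟨a + a' + 1, -z, by push_cast [ha, ha']; ring, ?_⟩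
    simp only [axisCount, ha, ha'] at hz
    push_cast at hz
    linear_combination -hz
  · rw [S.axisPoint_odd (Nat.not_even_iff_odd.2 hm), S.axisPoint_even hm',
      ZMod.intCast_eq_intCast_iff_dvd_sub] at h
    obtain ⟨z, hz⟩ := h
    obtain ⟨a, ha⟩ := hm
    obtain ⟨a', ha'⟩ := hm'
    refine Or.inr ⟨a + a' + 1, z, by push_cast [ha, ha']; ring, ?_⟩
    simp only [axisCount, ha, ha'] at hz
    push_cast at hz
    linear_combination hz
  · rw [S.axisPoint_odd (Nat.not_even_iff_odd.2 hm), S.axisPoint_odd (Nat.not_even_iff_odd.2 hm'),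
      ZMod.intCast_eq_intCast_iff_dvd_sub] at h
    obtain ⟨z, hz⟩ := h
    obtain ⟨a, ha⟩ := hm
    obtain ⟨a', ha'⟩ := hm'
    refine Or.inl ⟨a - a', z, by push_cast [ha, ha']; ring, ?_⟩
    simp only [axisCount, ha, ha'] at hz
    push_cast at hz
    linear_combination hz

/-- The lattice coordinates, with respect to the basis `(q, p)`, `(t, r)`, of the puncture at which
the final arc `(ε, κ)` starts. -/
theorem exists_coords (ε κ : ℕ) : ∃ u v : ℤ,
    (if κ < (S.path i).y then u = ε ∧ v = 0 else u = 0 ∧ v = ε) ∧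
    (S.rayCol i ε κ : ℤ) = u * (S.path i).q + v * (S.path i).t ∧
    S.rayLine i ε κ = u * (S.path i).y - v * (S.path i).x + κ := by
  unfold rayCol rayLine
  split_ifs
  · exact ⟨ε, 0, ⟨rfl, rfl⟩, by push_cast; ring, by ring⟩
  · exact ⟨0, ε, ⟨rfl, rfl⟩, by push_cast; ring, by ring⟩

/-- Every even lattice vector `(2 d, 2 z)` has even coordinates in the basis `(q, p)`, `(t, r)`; the
second equation computes the effect of the translation on the numbers of the lines. -/
theorem exists_half_coords (d z : ℤ) : ∃ e f : ℤ,
    d = e * (S.path i).q + f * (S.path i).t ∧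
    z * (S.s + S.b) - d * (S.path i).coordC = e * (S.path i).y - f * (S.path i).x := by
  have h := (S.path i).edge
  refine ⟨z * (S.path i).t - d * (S.path i).r, (S.path i).p * d - (S.path i).q * z, ?_, ?_⟩
  · linear_combination (- d) * h
  · rw [S.s_add_b_cast i, Edgepath.coordC]
    ring

/-- The final arcs in a ball meet the axis in different points. -/
theorem ray_injective {ε ε' κ κ' k k' : ℕ} (hε : ε < 2) (hε' : ε' < 2) (hκ : κ < S.s)
    (hκ' : κ' < S.s) (hk : k < S.rayLen i κ) (hk' : k' < S.rayLen i κ')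
    (h : S.axisPoint i (S.rayLine i ε κ) (S.rayCol i ε κ + k) =
      S.axisPoint i (S.rayLine i ε' κ') (S.rayCol i ε' κ' + k')) :
    ε = ε' ∧ κ = κ' ∧ k = k' := by
  have hs := S.x_add_y i
  have ht := (S.path i).t_pos
  have htq := (S.path i).t_lt_q
  obtain ⟨u, v, huv, hm, hℓ⟩ := S.exists_coords i ε κ
  obtain ⟨u', v', huv', hm', hℓ'⟩ := S.exists_coords i ε' κ'
  unfold rayLen at hk hk'
  rcases S.axisPoint_eq h with ⟨d, z, hd, hz⟩ | ⟨d, z, hd, hz⟩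
  · obtain ⟨e, f, h1, h2⟩ := S.exists_half_coords i d z
    push_cast at hd
    have h0 := eq_zero_of_arcs_meet (q := (S.path i).q) (t := (S.path i).t) (x := (S.path i).x)
      (y := (S.path i).y) (κ := κ) (κ' := κ') (k := k) (k' := k') (U := u - u' - 2 * e)
      (V := v - v' - 2 * f) (by omega) (by omega) (by omega) (by omega) (by omega) (by omega)
      (by omega) (by omega) (by omega) (by split_ifs at hk ⊢ <;> omega) (by omega)
      (by split_ifs at hk' ⊢ <;> omega)
      (by linear_combination hℓ - hℓ' - hz - 2 * h2)
      (by linear_combination hm - hm' - hd - 2 * h1)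
    have hκκ : (κ' : ℤ) - κ = 0 := by
      have : (κ' : ℤ) - κ = (u - u' - 2 * e) * (S.path i).y - (v - v' - 2 * f) * (S.path i).x := by
        linear_combination hℓ - hℓ' - hz - 2 * h2
      rw [this, h0.1, h0.2]; ring
    have hkk : (k' : ℤ) - k = 0 := by
      have : (k' : ℤ) - k = (u - u' - 2 * e) * (S.path i).q + (v - v' - 2 * f) * (S.path i).t := by
        linear_combination hm - hm' - hd - 2 * h1
      rw [this, h0.1, h0.2]; ring
    have hκ2 : κ = κ' := by omega
    subst hκ2
    refine ⟨?_, rfl, by omega⟩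
    split_ifs at huv huv' <;> omega
  · -- The half-turn takes the second arc to an arc whose starting point is not among the chosen ones.
    exfalso
    obtain ⟨e, f, h1, h2⟩ := S.exists_half_coords i d z
    push_cast at hd
    by_cases hc : κ' < (S.path i).y
    · rw [if_pos hc] at hk' huv'
      have e1 : ((S.path i).y - 1 - κ' : ℤ) - κ =
          (u + u' - 2 * e) * (S.path i).y - (v + v' + 1 - 2 * f) * (S.path i).x := by
        have : (S.s : ℤ) = (S.path i).x + (S.path i).y := by omega
        linear_combination hℓ + hℓ' - hz - 2 * h2 - this
      have e2 : ((S.path i).t - 1 - k' : ℤ) - k =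
          (u + u' - 2 * e) * (S.path i).q + (v + v' + 1 - 2 * f) * (S.path i).t := by
        linear_combination hm + hm' - hd - 2 * h1
      have h0 := eq_zero_of_arcs_meet (q := (S.path i).q) (t := (S.path i).t) (x := (S.path i).x)
        (y := (S.path i).y) (κ := κ) (k := k) (by omega) (by omega) (by omega) (by omega) (by omega)
        (by omega) (by omega) (by omega) (by omega) (by split_ifs at hk ⊢ <;> omega) (by omega)
        (by rw [if_pos (by omega)]; omega) e1 e2
      rw [h0.1, h0.2] at e1
      split_ifs at huv <;> omega
    · rw [if_neg hc] at hk' huv'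
      have e1 : (S.s - 1 - κ' + (S.path i).y : ℤ) - κ =
          (u + u' + 1 - 2 * e) * (S.path i).y - (v + v' - 2 * f) * (S.path i).x := by
        linear_combination hℓ + hℓ' - hz - 2 * h2
      have e2 : ((S.path i).q - 1 - k' : ℤ) - k =
          (u + u' + 1 - 2 * e) * (S.path i).q + (v + v' - 2 * f) * (S.path i).t := by
        linear_combination hm + hm' - hd - 2 * h1
      have h0 := eq_zero_of_arcs_meet (q := (S.path i).q) (t := (S.path i).t) (x := (S.path i).x)
        (y := (S.path i).y) (κ := κ) (k := k) (by omega) (by omega) (by omega) (by omega) (by omega)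
        (by omega) (by omega) (by omega) (by omega) (by split_ifs at hk ⊢ <;> omega) (by omega)
        (by rw [if_neg (by omega)]; omega) e1 e2
      rw [h0.1, h0.2] at e1
      split_ifs at huv <;> omega

theorem sum_rayLen : ∑ κ ∈ Finset.range S.s, S.rayLen i κ = S.s + S.b := by
  rw [S.s_add_b i, ← S.x_add_y i, add_comm (S.path i).x, Finset.sum_range_add]
  have h1 : ∑ κ ∈ Finset.range (S.path i).y, S.rayLen i κ = (S.path i).y * (S.path i).t := by
    rw [Finset.sum_congr rfl fun κ hκ => show S.rayLen i κ = (S.path i).t from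
      if_pos (Finset.mem_range.1 hκ)]
    simp
  have h2 : ∑ κ ∈ Finset.range (S.path i).x, S.rayLen i ((S.path i).y + κ) =
      (S.path i).x * (S.path i).q := by
    rw [Finset.sum_congr rfl fun κ _ => show S.rayLen i ((S.path i).y + κ) = (S.path i).q from
      if_neg (by omega)]
    simp
  rw [h1, h2, add_comm]

/-- The final arcs in a ball cover all points in which the surface meets the axis. -/
theorem ray_surjective (l : ZMod S.axisCount) : ∃ ε κ k : ℕ, ε < 2 ∧ κ < S.s ∧ k < S.rayLen i κ ∧
    S.axisPoint i (S.rayLine i ε κ) (S.rayCol i ε κ + k) = l := by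
  have hN : S.axisCount ≠ 0 := by
    have := S.s_pos
    unfold axisCount
    omega
  have : NeZero S.axisCount := ⟨hN⟩
  let g : (Σ a : Fin 2 × Fin S.s, Fin (S.rayLen i a.2)) → ZMod S.axisCount := fun c =>
    S.axisPoint i (S.rayLine i c.1.1 c.1.2) (S.rayCol i c.1.1 c.1.2 + c.2)
  have hg : Function.Injective g := by
    rintro ⟨⟨ε, κ⟩, k⟩ ⟨⟨ε', κ'⟩, k'⟩ h
    obtain ⟨h1, h2, h3⟩ := S.ray_injective i ε.2 ε'.2 κ.2 κ'.2 k.2 k'.2 h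
    obtain rfl := Fin.ext h1
    obtain rfl := Fin.ext h2
    obtain rfl := Fin.ext h3
    rfl
  have hcard : Fintype.card (Σ a : Fin 2 × Fin S.s, Fin (S.rayLen i a.2)) =
      Fintype.card (ZMod S.axisCount) := by
    rw [ZMod.card, Fintype.card_sigma, Fintype.sum_prod_type]
    simp only [Fintype.card_fin]
    rw [Fin.sum_const, Fin.sum_univ_eq_sum_range (fun κ => S.rayLen i κ), S.sum_rayLen]
    rfl
  obtain ⟨⟨⟨ε, κ⟩, k⟩, h⟩ := ((Fintype.bijective_iff_injective_and_card g).2 ⟨hg, hcard⟩).2 l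
  exact ⟨ε, κ, k, ε.2, κ.2, k.2, h⟩

/-- The line number `ℓ` of the `i`-th ball runs into a slit in column `m`. -/
def OnSlit (m : ℕ) (ℓ : ℤ) : Prop :=
  ∃ (n : ℤ) (κ : ℕ), κ < S.s ∧ ℓ = S.slitBase i m n + κ

/-- A final arc ends at the first slit that it meets. -/
theorem ray_onSlit_iff {ε κ k : ℕ} (hκ : κ < S.s) (hk : k ≤ S.rayLen i κ) :
    S.OnSlit i (S.rayCol i ε κ + k) (S.rayLine i ε κ) ↔ k = 0 ∨ k = S.rayLen i κ := by
  have hs := S.x_add_y i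
  have ht := (S.path i).t_pos
  have htq := (S.path i).t_lt_q
  have hq := S.q_pos i
  have hp := S.slitBase_q i
  have hr := S.slitBase_t i
  have hedge := (S.path i).edge
  obtain ⟨u, v, huv, hm, hℓ⟩ := S.exists_coords i ε κ
  have hD := S.s_add_b_cast i
  constructor
  · rintro ⟨n, κ', hκ', h⟩
    by_contra! hc
    have hk' : k < S.rayLen i κ := by omega
    unfold rayLen at hk'
    rw [slitBase, Edgepath.coordC] at h
    push_cast at h
    obtain ⟨w, hw⟩ : ∃ w : ℤ, w = S.rayCol i ε κ + k := ⟨_, rfl⟩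
    rw [← hw] at h
    have h0 := eq_zero_of_arcs_meet (q := (S.path i).q) (t := (S.path i).t) (x := (S.path i).x)
      (y := (S.path i).y) (κ := κ) (κ' := κ') (k := k) (k' := 0)
      (U := u - (n * (S.path i).t - w * (S.path i).r))
      (V := v - ((S.path i).p * w - (S.path i).q * n))
      (by omega) (by omega) (by omega) (by omega) (by omega) (by omega)
      (by omega) (by omega) (by omega) (by split_ifs at hk' ⊢ <;> omega) (by omega)
      (by split_ifs <;> omega)
      (by rw [hD] at h; linear_combination hℓ - h)
      (by linear_combination w * hedge + hm + hw)
    have : (0 : ℤ) - k = (u - (n * (S.path i).t - w * (S.path i).r)) * (S.path i).q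
        + (v - ((S.path i).p * w - (S.path i).q * n)) * (S.path i).t := by
      linear_combination w * hedge + hm + hw
    rw [h0.1, h0.2] at this
    omega
  · unfold slitBase at hp hr
    rintro (rfl | rfl)
    · refine ⟨u * (S.path i).p + v * (S.path i).r, κ, hκ, ?_⟩
      rw [add_zero, slitBase, hm, hℓ]
      linear_combination -u * hp - v * hr
    · unfold rayLen
      split_ifs with hc
      · refine ⟨u * (S.path i).p + (v + 1) * (S.path i).r, (S.path i).x + κ, by omega, ?_⟩
        rw [slitBase]
        push_cast
        rw [hm, hℓ]
        linear_combination -u * hp - (v + 1) * hr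
      · refine ⟨(u + 1) * (S.path i).p + v * (S.path i).r, κ - (S.path i).y, by omega, ?_⟩
        rw [slitBase]
        push_cast [show (S.path i).y ≤ κ by omega]
        rw [hm, hℓ]
        linear_combination -(u + 1) * hp - v * hr

/-! ### The arcs in the walls -/

theorem offset_succ : S.offset (i + 1) = S.offset i - (S.path i).coordC := by
  have hv := S.vertical
  rw [Fin.sum_univ_three] at hv
  have h0 : (Finset.univ.filter (· < (0 : Fin 3))) = ∅ := by decide
  have h1 : (Finset.univ.filter (· < (1 : Fin 3))) = {0} := by decide
  have h2 : (Finset.univ.filter (· < (2 : Fin 3))) = {0, 1} := by decide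
  unfold offset
  fin_cases i
  · change -∑ j ∈ Finset.univ.filter (· < (1 : Fin 3)), _ =
      -∑ j ∈ Finset.univ.filter (· < (0 : Fin 3)), _ - _
    simp only [h0, h1, Finset.sum_empty, Finset.sum_singleton]
    change _ = _ - (S.path 0).coordC
    ring
  · change -∑ j ∈ Finset.univ.filter (· < (2 : Fin 3)), _ =
      -∑ j ∈ Finset.univ.filter (· < (1 : Fin 3)), _ - _
    simp only [h1, h2, Finset.sum_singleton,
      Finset.sum_pair (show (0 : Fin 3) ≠ 1 by decide)]
    change _ = _ - (S.path 1).coordC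
    ring
  · change -∑ j ∈ Finset.univ.filter (· < (0 : Fin 3)), _ =
      -∑ j ∈ Finset.univ.filter (· < (2 : Fin 3)), _ - _
    simp only [h0, h2, Finset.sum_empty, Finset.sum_pair (show (0 : Fin 3) ≠ 1 by decide)]
    change _ = _ - (S.path 2).coordC
    linarith

theorem wallOf_ne_wallOf_succ (m : ℕ) : wallOf i m ≠ wallOf i (m + 1) := by
  unfold wallOf
  by_cases h : Even m
  · simp [h, Nat.even_add_one]
  · simp [h, Nat.even_add_one]

theorem wallOf_eq_or (m : ℕ) : wallOf i m = i ∨ wallOf i m = i + 1 := by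
  unfold wallOf
  split_ifs <;> simp

theorem wallOf_eq_iff (m : ℕ) : wallOf i m = i ↔ Even m := by
  unfold wallOf
  split_ifs with h <;> simp [h]

/-- The arc of the wall `w` that leaves the axis at the point `l` ends at a puncture. The definition
refers to the wall only, not to one of the two balls that contain it. -/
def IsKnotEnd (w : Fin 3) (l : ZMod S.axisCount) : Prop :=
  ∃ (n : ℤ) (κ : ℕ), κ < S.s ∧ l = ((n * (S.s + S.b) + κ + S.offset w : ℤ) : ZMod S.axisCount)

open Classical in
/-- The arc of the wall `w` that leaves the axis at the point `l`, directed away from `l`. If it does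
not end at a puncture, then it returns to the axis at the image of `l` under the half-turn about a
puncture of the wall. -/
noncomputable def wallDart (w : Fin 3) (l : ZMod S.axisCount) : S.SDart where
  name := .wall w
  src := .axis l
  tgt := if S.IsKnotEnd w l then .knot w l
    else .axis (((S.s - 1 + 2 * S.offset w : ℤ) : ZMod S.axisCount) - l)

theorem isKnotEnd_axisPoint (ℓ : ℤ) (m : ℕ) :
    S.IsKnotEnd (wallOf i m) (S.axisPoint i ℓ m) ↔ S.OnSlit i m ℓ := by
  unfold IsKnotEnd OnSlit slitBase wallOf
  by_cases hm : Even m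
  · rw [if_pos hm, S.axisPoint_even hm]
    constructor
    · rintro ⟨n, κ, hκ, h⟩
      rw [ZMod.intCast_eq_intCast_iff_dvd_sub] at h
      obtain ⟨z, hz⟩ := h
      refine ⟨n - 2 * z, κ, hκ, ?_⟩
      simp only [axisCount] at hz
      push_cast at hz
      linear_combination -hz
    · rintro ⟨n, κ, hκ, rfl⟩
      exact ⟨n, κ, hκ, congrArg _ (by ring)⟩
  · rw [if_neg hm, S.axisPoint_odd hm]
    constructor
    · rintro ⟨n, κ, hκ, h⟩
      rw [ZMod.intCast_eq_intCast_iff_dvd_sub, offset_succ] at h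
      obtain ⟨z, hz⟩ := h
      refine ⟨2 * z - n, S.s - 1 - κ, by omega, ?_⟩
      rw [show ((S.s - 1 - κ : ℕ) : ℤ) = S.s - 1 - κ by omega]
      simp only [axisCount] at hz
      push_cast at hz
      linear_combination hz
    · rintro ⟨n, κ, hκ, rfl⟩
      refine ⟨-n, S.s - 1 - κ, by omega, congrArg _ ?_⟩
      rw [show ((S.s - 1 - κ : ℕ) : ℤ) = S.s - 1 - κ by omega, offset_succ]
      ring

theorem isKnotEnd_axisPoint_succ (ℓ : ℤ) (m : ℕ) :
    S.IsKnotEnd (wallOf i (m + 1)) (S.axisPoint i ℓ m) ↔ S.OnSlit i (m + 1) ℓ := by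
  unfold IsKnotEnd OnSlit slitBase wallOf
  by_cases hm : Even m
  · rw [if_neg (by simpa [Nat.even_add_one] using hm), S.axisPoint_even hm]
    constructor
    · rintro ⟨n, κ, hκ, h⟩
      rw [ZMod.intCast_eq_intCast_iff_dvd_sub, offset_succ] at h
      obtain ⟨z, hz⟩ := h
      refine ⟨n - 2 * z, κ, hκ, ?_⟩
      simp only [axisCount] at hz
      push_cast at hz ⊢
      linear_combination -hz
    · rintro ⟨n, κ, hκ, rfl⟩
      exact ⟨n, κ, hκ, congrArg _ (by rw [offset_succ]; push_cast; ring)⟩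
  · rw [if_pos (by simpa [Nat.even_add_one] using hm), S.axisPoint_odd hm]
    constructor
    · rintro ⟨n, κ, hκ, h⟩
      rw [ZMod.intCast_eq_intCast_iff_dvd_sub] at h
      obtain ⟨z, hz⟩ := h
      refine ⟨2 * z - n, S.s - 1 - κ, by omega, ?_⟩
      rw [show ((S.s - 1 - κ : ℕ) : ℤ) = S.s - 1 - κ by omega]
      simp only [axisCount] at hz
      push_cast at hz ⊢
      linear_combination hz
    · rintro ⟨n, κ, hκ, rfl⟩
      refine ⟨-n, S.s - 1 - κ, by omega, congrArg _ ?_⟩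
      rw [show ((S.s - 1 - κ : ℕ) : ℤ) = S.s - 1 - κ by omega]
      push_cast
      ring

theorem axisPoint_succ (ℓ : ℤ) (m : ℕ) : S.axisPoint i ℓ (m + 1) =
    ((S.s - 1 + 2 * S.offset (wallOf i (m + 1)) : ℤ) : ZMod S.axisCount) - S.axisPoint i ℓ m := by
  unfold wallOf
  by_cases hm : Even m
  · have hm' : ¬ Even (m + 1) := by simpa [Nat.even_add_one] using hm
    rw [if_neg hm', S.axisPoint_even hm, S.axisPoint_odd hm', offset_succ]
    push_cast
    ring
  · have hm' : Even (m + 1) := by simpa [Nat.even_add_one] using hm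
    rw [if_pos hm', S.axisPoint_odd hm, S.axisPoint_even hm']
    push_cast
    ring

/-- The `k`-th piece of `arc i m ℓ len`. -/
def arcDart (m : ℕ) (ℓ : ℤ) (len k : ℕ) : S.SDart where
  name := .wall (wallOf i (m + k))
  src := if k = 0 then .knot (wallOf i m) (S.axisPoint i ℓ m)
    else .axis (S.axisPoint i ℓ (m + k - 1))
  tgt := if k = len then .knot (wallOf i (m + len)) (S.axisPoint i ℓ (m + len - 1))
    else .axis (S.axisPoint i ℓ (m + k))

theorem arc_eq_map (m : ℕ) (ℓ : ℤ) (len : ℕ) :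
    S.arc i m ℓ len = (List.range (len + 1)).map (S.arcDart i m ℓ len) := rfl

/-- An arc that ends at the first slit that it meets arrives at the axis along an arc of a wall. -/
theorem arcDart_eq_reverse {m : ℕ} {ℓ : ℤ} {len k : ℕ}
    (hslit : ∀ k ≤ len, (S.OnSlit i (m + k) ℓ ↔ k = 0 ∨ k = len)) (hk : k < len) :
    S.arcDart i m ℓ len k = (S.wallDart (wallOf i (m + k)) (S.axisPoint i ℓ (m + k))).reverse := by
  unfold arcDart wallDart Dart.reverse
  rw [Dart.mk.injEq]
  refine ⟨rfl, ?_, by simp [hk.ne]⟩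
  simp only [S.isKnotEnd_axisPoint, hslit k hk.le]
  rcases k with _ | k
  · simp
  · simp only [Nat.add_one_ne_zero, if_false, false_or, hk.ne]
    rw [← Nat.add_assoc, S.axisPoint_succ i ℓ (m + k), sub_sub_cancel]
    rfl

/-- An arc that ends at the first slit that it meets leaves the axis along an arc of a wall. -/
theorem arcDart_succ_eq {m : ℕ} {ℓ : ℤ} {len k : ℕ}
    (hslit : ∀ k ≤ len, (S.OnSlit i (m + k) ℓ ↔ k = 0 ∨ k = len)) (hk : k < len) :
    S.arcDart i m ℓ len (k + 1) = S.wallDart (wallOf i (m + (k + 1))) (S.axisPoint i ℓ (m + k)) := by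
  unfold arcDart wallDart
  rw [Dart.mk.injEq]
  refine ⟨rfl, rfl, ?_⟩
  have h := (S.isKnotEnd_axisPoint_succ i ℓ (m + k)).trans (hslit (k + 1) hk)
  rw [← Nat.add_assoc m k 1]
  by_cases hkl : k + 1 = len
  · rw [if_pos hkl, if_pos (h.2 (Or.inr hkl)), ← hkl]
    rfl
  · rw [if_neg hkl, if_neg (fun hc => by have := h.1 hc; omega), S.axisPoint_succ i ℓ (m + k)]

/-- The final arc `(ε, κ)` in the `i`-th ball. -/
def ray (ε κ : ℕ) : List S.SDart := S.arc i (S.rayCol i ε κ) (S.rayLine i ε κ) (S.rayLen i κ)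

theorem mem_ray {ε κ : ℕ} {d : S.SDart} : d ∈ S.ray i ε κ ↔
    ∃ k ≤ S.rayLen i κ, S.arcDart i (S.rayCol i ε κ) (S.rayLine i ε κ) (S.rayLen i κ) k = d := by
  simp [ray, arc_eq_map]

theorem rayDart_eq_reverse {ε κ k : ℕ} (hκ : κ < S.s) (hk : k < S.rayLen i κ) :
    S.arcDart i (S.rayCol i ε κ) (S.rayLine i ε κ) (S.rayLen i κ) k =
      (S.wallDart (wallOf i (S.rayCol i ε κ + k))
        (S.axisPoint i (S.rayLine i ε κ) (S.rayCol i ε κ + k))).reverse :=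
  S.arcDart_eq_reverse i (fun _ hk => S.ray_onSlit_iff i hκ hk) hk

theorem rayDart_succ_eq {ε κ k : ℕ} (hκ : κ < S.s) (hk : k < S.rayLen i κ) :
    S.arcDart i (S.rayCol i ε κ) (S.rayLine i ε κ) (S.rayLen i κ) (k + 1) =
      S.wallDart (wallOf i (S.rayCol i ε κ + (k + 1)))
        (S.axisPoint i (S.rayLine i ε κ) (S.rayCol i ε κ + k)) :=
  S.arcDart_succ_eq i (fun _ hk => S.ray_onSlit_iff i hκ hk) hk

theorem exists_sameEdge_of_mem_ray {ε κ : ℕ} (hκ : κ < S.s) {d : S.SDart}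
    (hd : d ∈ S.ray i ε κ) : ∃ w l, d = S.wallDart w l ∨ d = (S.wallDart w l).reverse := by
  obtain ⟨k, hk, rfl⟩ := (S.mem_ray i).1 hd
  rcases hk.lt_or_eq with hk | hk
  · exact ⟨_, _, Or.inr (S.rayDart_eq_reverse i hκ hk)⟩
  · obtain ⟨k', rfl⟩ : ∃ k', k = k' + 1 := ⟨k - 1, by have := S.rayLen_pos i κ; omega⟩
    exact ⟨_, _, Or.inl (S.rayDart_succ_eq i hκ (by omega))⟩

/-- Every arc of the two walls of a ball is contained in exactly one of the final arcs in the
ball. -/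
theorem existsUnique_rayDart {w : Fin 3} (hw : w = i ∨ w = i + 1) (l : ZMod S.axisCount) :
    ∃ ε κ k : ℕ, (ε < 2 ∧ κ < S.s ∧ k ≤ S.rayLen i κ) ∧
      ∀ ε' κ' k' : ℕ, ε' < 2 → κ' < S.s → k' ≤ S.rayLen i κ' →
        ((S.wallDart w l).SameEdge
          (S.arcDart i (S.rayCol i ε' κ') (S.rayLine i ε' κ') (S.rayLen i κ') k') ↔
          ε' = ε ∧ κ' = κ ∧ k' = k) := by
  obtain ⟨ε, κ, k, hε, hκ, hk, hl⟩ := S.ray_surjective i l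
  -- A piece with the end point `l` is one of the two pieces next to the only crossing at `l`.
  have main : ∀ ε' κ' k' : ℕ, ε' < 2 → κ' < S.s → k' ≤ S.rayLen i κ' →
      (S.wallDart w l).SameEdge
          (S.arcDart i (S.rayCol i ε' κ') (S.rayLine i ε' κ') (S.rayLen i κ') k') →
      ε' = ε ∧ κ' = κ ∧ (k' = k ∨ k' = k + 1) ∧ w = wallOf i (S.rayCol i ε κ + k') := by
    intro ε' κ' k' hε' hκ' hk' h
    have hname : w = wallOf i (S.rayCol i ε' κ' + k') := by
      rcases h with h | h
      · have := congrArg Dart.name h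
        simpa [arcDart, wallDart] using this.symm
      · have := congrArg Dart.name h
        simpa [arcDart, wallDart, Dart.reverse] using this.symm
    have hcross : (k' < S.rayLen i κ' ∧
        S.axisPoint i (S.rayLine i ε' κ') (S.rayCol i ε' κ' + k') = l) ∨
        (k' ≠ 0 ∧ S.axisPoint i (S.rayLine i ε' κ') (S.rayCol i ε' κ' + (k' - 1)) = l) := by
      rcases h with h | h
      · have := congrArg Dart.src h
        simp only [arcDart, wallDart] at this
        split_ifs at this with h0
        right
        refine ⟨h0, ?_⟩
        rw [← Nat.add_sub_assoc (by omega)]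
        exact Vertex.axis.inj this
      · have := congrArg Dart.tgt h
        simp only [arcDart, wallDart, Dart.reverse] at this
        split_ifs at this with h0
        left
        exact ⟨lt_of_le_of_ne hk' h0, Vertex.axis.inj this⟩
    rcases hcross with ⟨h1, h2⟩ | ⟨h1, h2⟩
    · obtain ⟨rfl, rfl, rfl⟩ := S.ray_injective i hε' hε hκ' hκ h1 hk (h2.trans hl.symm)
      exact ⟨rfl, rfl, Or.inl rfl, hname⟩
    · obtain ⟨rfl, rfl, h3⟩ := S.ray_injective i hε' hε hκ' hκ (by omega) hk (h2.trans hl.symm)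
      exact ⟨rfl, rfl, Or.inr (by omega), hname⟩
  have hne := wallOf_ne_wallOf_succ i (S.rayCol i ε κ + k)
  by_cases hwk : w = wallOf i (S.rayCol i ε κ + k)
  · refine ⟨ε, κ, k, ⟨hε, hκ, hk.le⟩, fun ε' κ' k' hε' hκ' hk' => ⟨fun h => ?_, ?_⟩⟩
    · obtain ⟨h1, h2, h3 | h3, h4⟩ := main ε' κ' k' hε' hκ' hk' h
      · exact ⟨h1, h2, h3⟩
      · subst h3
        exact absurd (hwk.symm.trans h4) hne
    · rintro ⟨rfl, rfl, rfl⟩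
      rw [S.rayDart_eq_reverse i hκ hk, hl, ← hwk]
      exact Or.inr rfl
  · have hwk' : w = wallOf i (S.rayCol i ε κ + (k + 1)) := by
      have e1 := wallOf_eq_or i (S.rayCol i ε κ + k)
      have e2 := wallOf_eq_or i (S.rayCol i ε κ + k + 1)
      rw [← Nat.add_assoc]
      revert hwk hne e1 e2 hw
      generalize wallOf i (S.rayCol i ε κ + k) = a
      generalize wallOf i (S.rayCol i ε κ + k + 1) = b
      clear * -
      revert w i a b
      decide
    refine ⟨ε, κ, k + 1, ⟨hε, hκ, hk⟩, fun ε' κ' k' hε' hκ' hk' => ⟨fun h => ?_, ?_⟩⟩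
    · obtain ⟨h1, h2, h3 | h3, h4⟩ := main ε' κ' k' hε' hκ' hk' h
      · subst h3
        exact absurd h4 hwk
      · exact ⟨h1, h2, h3⟩
    · rintro ⟨rfl, rfl, rfl⟩
      rw [S.rayDart_succ_eq i hκ hk, hl, ← hwk']
      exact Or.inl rfl

open Classical in
/-- An arc of the left or the right wall of a ball is a piece of exactly one final arc in the ball, and
an arc of the third wall is a piece of none. -/
theorem sum_wordCount_ray (w : Fin 3) (l : ZMod S.axisCount) :
    ∑ ε ∈ Finset.range 2, ∑ κ ∈ Finset.range S.s,
      wordCount (S.wallDart w l).SameEdge (S.ray i ε κ) = if w = i ∨ w = i + 1 then 1 else 0 := by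
  split_ifs with hw
  · obtain ⟨ε, κ, k, ⟨hε, hκ, hk⟩, h⟩ := S.existsUnique_rayDart i hw l
    have hsum : ∀ ε' ∈ Finset.range 2, ∀ κ' ∈ Finset.range S.s,
        wordCount (S.wallDart w l).SameEdge (S.ray i ε' κ') =
          if ε' = ε then if κ' = κ then 1 else 0 else 0 := by
      intro ε' hε' κ' hκ'
      rw [Finset.mem_range] at hε' hκ'
      rw [ray, arc_eq_map, wordCount_map_range]
      by_cases h1 : ε' = ε ∧ κ' = κ
      · obtain ⟨rfl, rfl⟩ := h1
        rw [Finset.sum_eq_single k]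
        · rw [if_pos ((h _ _ _ hε' hκ' hk).2 ⟨rfl, rfl, rfl⟩), if_pos rfl, if_pos rfl]
        · intro k' hk' hne
          rw [if_neg]
          intro hs
          exact hne ((h _ _ _ hε' hκ' (Nat.lt_succ_iff.1 (Finset.mem_range.1 hk'))).1 hs).2.2
        · intro hk'
          exact absurd (Finset.mem_range.2 (Nat.lt_succ_iff.2 hk)) hk'
      · rw [Finset.sum_eq_zero]
        · split_ifs <;> tauto
        · intro k' hk'
          rw [if_neg]
          intro hs
          have h2 := (h _ _ _ hε' hκ' (Nat.lt_succ_iff.1 (Finset.mem_range.1 hk'))).1 hs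
          exact h1 ⟨h2.1, h2.2.1⟩
    rw [Finset.sum_congr rfl fun ε' hε' => Finset.sum_congr rfl (hsum ε' hε')]
    simp only [Finset.sum_ite_irrel, Finset.sum_ite_eq', Finset.sum_const_zero, Finset.mem_range,
      hε, hκ, if_true]
  · refine Finset.sum_eq_zero fun ε _ => Finset.sum_eq_zero fun κ _ => ?_
    refine wordCount_eq_zero fun d hd hs => hw ?_
    obtain ⟨k, -, rfl⟩ := (S.mem_ray i).1 hd
    have hname : w = wallOf i (S.rayCol i ε κ + k) := by
      rcases hs with h | h
      · have := congrArg Dart.name h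
        simpa [arcDart, wallDart] using this.symm
      · have := congrArg Dart.name h
        simpa [arcDart, wallDart, Dart.reverse] using this.symm
    rw [hname]
    exact wallOf_eq_or i _

/-! ### The boundary words of sheets and saddles -/

/-- The two families of sheets, encoded by the truth values. -/
def familyEquiv : Bool ≃ Family where
  toFun b := if b then .beta else .alpha
  invFun f := match f with | .alpha => false | .beta => true
  left_inv := by rintro (_ | _) <;> rfl
  right_inv := by rintro (_ | _) <;> rfl

instance : Fintype Family := Fintype.ofEquiv Bool familyEquiv

theorem sum_family {M : Type*} [AddCommMonoid M] (h : Family → M) :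
    ∑ f, h f = h .alpha + h .beta := by
  rw [← Equiv.sum_comp familyEquiv, Fintype.sum_bool, add_comm]
  rfl

/-- The faces of a candidate surface, listed ball by ball. -/
def faceEquiv : (Σ i : Fin 3, (Family × Fin S.s) ⊕ Fin (S.path i).y) ≃ S.Face where
  toFun f := match f with
    | ⟨i, .inl (f, j)⟩ => .sheet i f j
    | ⟨i, .inr k⟩ => .saddle i k
  invFun f := match f with
    | .sheet i f j => ⟨i, .inl (f, j)⟩
    | .saddle i k => ⟨i, .inr k⟩
  left_inv := by rintro ⟨i, ⟨f, j⟩ | k⟩ <;> rfl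
  right_inv := by rintro (⟨i, f, j⟩ | ⟨i, k⟩) <;> rfl

instance : Fintype S.Face := Fintype.ofEquiv _ S.faceEquiv

theorem sum_face {M : Type*} [AddCommMonoid M] (h : S.Face → M) :
    ∑ f, h f = ∑ i, ((∑ j, h (.sheet i .alpha j) + ∑ j, h (.sheet i .beta j)) +
      ∑ k, h (.saddle i k)) := by
  rw [← Equiv.sum_comp S.faceEquiv, Fintype.sum_sigma]
  refine Finset.sum_congr rfl fun i _ => ?_
  rw [Fintype.sum_sum_type, Fintype.sum_prod_type, sum_family]
  rfl

/-- The position `(ε, κ)` of the `k`-th final copy of `α` or `β` among the final arcs. -/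
def sideRay : Family → ℕ → ℕ × ℕ
  | .alpha, k => (0, (S.path i).y + k)
  | .beta, k => (1, S.s - 1 - k)

theorem sideRay_lt {f : Family} {k : ℕ} (hk : k < (S.path i).x) :
    (S.sideRay i f k).1 < 2 ∧ (S.sideRay i f k).2 < S.s := by
  have := S.x_add_y i
  cases f <;> simp only [sideRay] <;> omega

theorem rayLen_sideRay {f : Family} {k : ℕ} (hk : k < (S.path i).x) :
    S.rayLen i (S.sideRay i f k).2 = (S.path i).q := by
  have := S.x_add_y i
  cases f
  · exact if_neg (show ¬ (S.path i).y + k < (S.path i).y by omega)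
  · exact if_neg (show ¬ S.s - 1 - k < (S.path i).y by omega)

theorem sideArc_eq {f : Family} {k : ℕ} (hk : k < (S.path i).x) :
    S.sideArc i f k = (S.rayCol i (S.sideRay i f k).1 (S.sideRay i f k).2,
      S.rayLine i (S.sideRay i f k).1 (S.sideRay i f k).2) := by
  have := S.x_add_y i
  cases f
  · simp [sideArc, sideRay, rayCol, rayLine]
  · have hκ : ¬ S.s - 1 - k < (S.path i).y := by omega
    change (_, _) = (S.rayCol i 1 (S.s - 1 - k), S.rayLine i 1 (S.s - 1 - k))
    rw [rayCol, rayLine, if_neg hκ, if_neg hκ, slitBase_t, Prod.mk.injEq]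
    exact ⟨by simp, by omega⟩

theorem arc_sideArc {f : Family} {k : ℕ} (hk : k < (S.path i).x) :
    S.arc i (S.sideArc i f k).1 (S.sideArc i f k).2 (S.path i).q =
      S.ray i (S.sideRay i f k).1 (S.sideRay i f k).2 := by
  rw [S.sideArc_eq i hk, ray, S.rayLen_sideRay i hk]

theorem arc_topLine {k : ℕ} (hk : k < (S.path i).y) :
    S.arc i (S.path i).q (S.topLine i k) (S.path i).t = S.ray i 1 k := by
  rw [ray, rayCol, rayLine, rayLen, if_pos hk, if_pos hk, if_pos hk, topLine, slitBase_q]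
  simp

theorem arc_bottomLine {k : ℕ} (hk : k < (S.path i).y) :
    S.arc i 0 (S.bottomLine i k) (S.path i).t = S.ray i 0 ((S.path i).y - 1 - k) := by
  rw [ray, rayCol, rayLine, rayLen, if_pos (by omega), if_pos (by omega), if_pos (by omega),
    bottomLine]
  have h : (((S.path i).y - 1 - k : ℕ) : ℤ) = (S.path i).y - 1 - k := by omega
  simp [h]

theorem name_of_mem_arc {m : ℕ} {ℓ : ℤ} {len : ℕ} {d : S.SDart} (hd : d ∈ S.arc i m ℓ len) :
    ∃ k, d.name = .wall (wallOf i k) := by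
  rw [arc_eq_map, List.mem_map] at hd
  obtain ⟨k, -, rfl⟩ := hd
  exact ⟨m + k, rfl⟩

theorem wordCount_arc_eq_zero {P : S.SDart → Prop} (hP : ∀ d w, d.name = .wall w → ¬ P d)
    (m : ℕ) (ℓ : ℤ) (len : ℕ) : wordCount P (S.arc i m ℓ len) = 0 :=
  wordCount_eq_zero fun d hd => by
    obtain ⟨k, hk⟩ := S.name_of_mem_arc i hd
    exact hP d _ hk

theorem wordCount_arc_reverse_eq_zero {P : S.SDart → Prop} (hP : ∀ d w, d.name = .wall w → ¬ P d)
    (m : ℕ) (ℓ : ℤ) (len : ℕ) :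
    wordCount P ((S.arc i m ℓ len).map Dart.reverse).reverse = 0 := by
  rw [wordCount_reverse, wordCount_map]
  exact S.wordCount_arc_eq_zero i (P := fun d => P d.reverse)
    (fun d w hd => hP d.reverse w hd) m ℓ len

variable (front : S.SaddleChoice)

/-- No saddle is attached to the `j`-th sheet of a family, so that the sheet reaches the boundary of
the ball. -/
def IsFreeSheet (j : ℕ) : Prop := (front i : ℕ) ≤ j ∧ j < front i + (S.path i).x

theorem front_le : (front i : ℕ) ≤ (S.path i).y := Nat.lt_succ_iff.1 (front i).2

theorem saddleSheet_lt {k : ℕ} (hk : k < (S.path i).y) : S.saddleSheet front i k < S.s := by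
  have := S.x_add_y i
  have := S.front_le i front
  unfold saddleSheet
  split_ifs <;> omega

theorem not_isFreeSheet_saddleSheet {k : ℕ} (hk : k < (S.path i).y) :
    ¬ S.IsFreeSheet i front (S.saddleSheet front i k) := by
  have := S.x_add_y i
  have := S.front_le i front
  unfold saddleSheet IsFreeSheet
  split_ifs <;> omega

theorem saddleSheet_injective {k k' : ℕ} (hk : k < (S.path i).y) (hk' : k' < (S.path i).y)
    (h : S.saddleSheet front i k = S.saddleSheet front i k') : k = k' := by
  have := S.x_add_y i
  have := S.front_le i front
  unfold saddleSheet at h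
  split_ifs at h <;> omega

/-- The number of the saddle that is attached to the `j`-th sheet. -/
def sheetSaddle (j : ℕ) : ℕ := if j < front i then front i - 1 - j else front i + (S.s - 1 - j)

theorem sheetSaddle_lt {j : ℕ} (hj : j < S.s) (h : ¬ S.IsFreeSheet i front j) :
    S.sheetSaddle i front j < (S.path i).y := by
  have := S.x_add_y i
  have := S.front_le i front
  unfold sheetSaddle
  unfold IsFreeSheet at h
  split_ifs <;> omega

theorem saddleSheet_sheetSaddle {j : ℕ} (hj : j < S.s) :
    S.saddleSheet front i (S.sheetSaddle i front j) = j := by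
  have := S.x_add_y i
  have := S.front_le i front
  unfold saddleSheet sheetSaddle
  split_ifs <;> omega

theorem sheetWord_of_isFreeSheet {f : Family} {j : ℕ} (h : S.IsFreeSheet i front j) :
    S.sheetWord front i f j = S.ray i (S.sideRay i f (j - front i)).1
      (S.sideRay i f (j - front i)).2 ++
      [S.rim i
        (S.arcEnd i (S.sideArc i f (j - front i)).1 (S.sideArc i f (j - front i)).2 (S.path i).q)
        (S.arcStart i (S.sideArc i f (j - front i)).1 (S.sideArc i f (j - front i)).2)] := by
  rw [← S.arc_sideArc i (by unfold IsFreeSheet at h; omega)]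
  exact if_pos h

theorem sheetWord_of_not_isFreeSheet {f : Family} {j : ℕ} (h : ¬ S.IsFreeSheet i front j) :
    S.sheetWord front i f j =
      [S.seam i f j, S.rim i (.inner i f j true) (.inner i f j false)] := by
  exact if_neg h

theorem mem_saddleWord {k : ℕ} (hk : k < (S.path i).y) {d : S.SDart}
    (hd : d ∈ S.saddleWord front i k) :
    d ∈ S.ray i 1 k ∨ d.reverse ∈ S.ray i 0 ((S.path i).y - 1 - k) ∨
    d = S.seam i .alpha (S.saddleSheet front i k) ∨
    d = (S.seam i .beta (S.saddleSheet front i k)).reverse ∨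
    (∃ f b w l, d = S.rim i (.inner i f (S.saddleSheet front i k) b) (.knot w l)) ∨
    (∃ f b w l, d = S.rim i (.knot w l) (.inner i f (S.saddleSheet front i k) b)) := by
  rw [← S.arc_topLine i hk, ← S.arc_bottomLine i hk]
  simp only [saddleWord, List.mem_append, List.mem_cons, List.not_mem_nil, or_false,
    List.mem_reverse, List.mem_map, arcStart, arcEnd] at hd
  rcases hd with ((((rfl | rfl) | h) | (rfl | rfl | rfl)) | ⟨d, h, rfl⟩) | rfl
  · exact Or.inr (Or.inr (Or.inl rfl))
  · exact Or.inr (Or.inr (Or.inr (Or.inr (Or.inl ⟨_, _, _, _, rfl⟩))))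
  · exact Or.inl h
  · exact Or.inr (Or.inr (Or.inr (Or.inr (Or.inr ⟨_, _, _, _, rfl⟩))))
  · exact Or.inr (Or.inr (Or.inr (Or.inl rfl)))
  · exact Or.inr (Or.inr (Or.inr (Or.inr (Or.inl ⟨_, _, _, _, rfl⟩))))
  · exact Or.inr (Or.inl h)
  · exact Or.inr (Or.inr (Or.inr (Or.inr (Or.inr ⟨_, _, _, _, rfl⟩))))

open Classical in
/-- The edges inside a ball that lie in the boundary of a saddle. -/
theorem wordCount_saddleWord {P : S.SDart → Prop} (hP : ∀ d w, d.name = .wall w → ¬ P d) (k : ℕ) :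
    wordCount P (S.saddleWord front i k) =
      wordCount P
        [S.seam i .alpha (S.saddleSheet front i k),
        (S.seam i .beta (S.saddleSheet front i k)).reverse,
        S.rim i (.inner i .alpha (S.saddleSheet front i k) true)
          (S.arcStart i (S.path i).q (S.topLine i k)),
        S.rim i (S.arcEnd i (S.path i).q (S.topLine i k) (S.path i).t)
          (.inner i .beta (S.saddleSheet front i k) true),
        S.rim i (.inner i .beta (S.saddleSheet front i k) false)
          (S.arcEnd i 0 (S.bottomLine i k) (S.path i).t),
        S.rim i (S.arcStart i 0 (S.bottomLine i k))
          (.inner i .alpha (S.saddleSheet front i k) false)] := by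
  simp only [saddleWord, wordCount_append, S.wordCount_arc_eq_zero i hP,
    S.wordCount_arc_reverse_eq_zero i hP, wordCount_cons, wordCount_nil]
  ring

/-- In each ball, the sides in the walls run once along every final arc. -/
theorem sum_wordCount_ball (w : Fin 3) (l : ZMod S.axisCount) :
    (∑ j : Fin S.s, wordCount (S.wallDart w l).SameEdge (S.sheetWord front i .alpha j) +
      ∑ j : Fin S.s, wordCount (S.wallDart w l).SameEdge (S.sheetWord front i .beta j)) +
      ∑ k : Fin (S.path i).y, wordCount (S.wallDart w l).SameEdge (S.saddleWord front i k) =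
    if w = i ∨ w = i + 1 then 1 else 0 := by
  have hs := S.x_add_y i
  have hf := S.front_le i front
  rw [← S.sum_wordCount_ray i w l]
  set P := (S.wallDart w l).SameEdge with hP
  have hP0 : ∀ d : S.SDart, (∀ w, d.name ≠ .wall w) → ¬ P d := by
    rintro d hd (rfl | rfl) <;> exact hd w rfl
  have hseam : ∀ f j, ¬ P (S.seam i f j) := fun f j => hP0 _ fun w => by simp [seam]
  have hrim : ∀ u v, ¬ P (S.rim i u v) := fun u v => hP0 _ fun w => by simp [rim]
  have hrev : ∀ d, P d.reverse ↔ P d := Dart.sameEdge_reverse_right _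
  have hsheet : ∀ f, ∑ j : Fin S.s, wordCount P (S.sheetWord front i f j) =
      ∑ k ∈ Finset.range (S.path i).x,
        wordCount P (S.ray i (S.sideRay i f k).1 (S.sideRay i f k).2) := by
    intro f
    rw [Fin.sum_univ_eq_sum_range (fun j => wordCount P (S.sheetWord front i f j)),
      ← Finset.sum_subset (s₁ := Finset.Ico (front i : ℕ) (front i + (S.path i).x))]
    · rw [Finset.sum_Ico_eq_sum_range, Nat.add_sub_cancel_left]
      refine Finset.sum_congr rfl fun k hk => ?_
      rw [Finset.mem_range] at hk
      rw [S.sheetWord_of_isFreeSheet i front ⟨by omega, by omega⟩, wordCount_append, wordCount_cons,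
        wordCount_nil, if_neg (hrim _ _), Nat.add_sub_cancel_left]
      simp
    · intro j hj
      rw [Finset.mem_Ico] at hj
      rw [Finset.mem_range]
      omega
    · intro j _ hj
      rw [Finset.mem_Ico] at hj
      rw [S.sheetWord_of_not_isFreeSheet i front hj]
      simp [wordCount_cons, wordCount_nil, hseam, hrim]
  have hsaddle : ∀ k ∈ Finset.range (S.path i).y, wordCount P (S.saddleWord front i k) =
      wordCount P (S.ray i 1 k) + wordCount P (S.ray i 0 ((S.path i).y - 1 - k)) := by
    intro k hk
    rw [Finset.mem_range] at hk
    rw [← S.arc_topLine i hk, ← S.arc_bottomLine i hk]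
    simp only [saddleWord, wordCount_append, wordCount_cons, wordCount_nil, wordCount_reverse,
      wordCount_map, hseam, hrim, hrev, if_false]
    ring
  rw [hsheet, hsheet, Fin.sum_univ_eq_sum_range (fun k => wordCount P (S.saddleWord front i k)),
    Finset.sum_congr rfl hsaddle, Finset.sum_add_distrib,
    Finset.sum_range_reflect (fun k => wordCount P (S.ray i 0 k)), Finset.sum_range_succ,
    Finset.sum_range_one, ← hs, add_comm (S.path i).x, Finset.sum_range_add, Finset.sum_range_add]
  have hbeta : ∑ k ∈ Finset.range (S.path i).x,
      wordCount P (S.ray i (S.sideRay i .beta k).1 (S.sideRay i .beta k).2) =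
      ∑ k ∈ Finset.range (S.path i).x, wordCount P (S.ray i 1 ((S.path i).y + k)) := by
    rw [← Finset.sum_range_reflect]
    refine Finset.sum_congr rfl fun k hk => ?_
    rw [Finset.mem_range] at hk
    simp only [sideRay]
    congr 2
    omega
  rw [hbeta]
  simp only [sideRay]
  ring

/-! ### Gluing the faces -/

/-- The ball that contains a face. -/
def faceBall : S.Face → Fin 3
  | .sheet i _ _ => i
  | .saddle i _ => i

/-- The two classes of faces along the glued edges: at an arc in the wall `w`, the faces in the ball
whose left wall is `w` and the other ones; at a seam, the sheets and the saddles. -/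
def faceClass (f : S.Face) : EdgeName → Bool
  | .wall w => decide (S.faceBall f = w)
  | .seam _ => match f with
    | .sheet _ _ _ => true
    | .saddle _ _ => false
  | .rim _ => true

/-- Each of the two balls that share a wall contributes one side to every arc in the wall. -/
theorem sum_wordCount_wallDart (w : Fin 3) (l : ZMod S.axisCount) (b : Bool) :
    ∑ f : S.Face, wordCount (fun d => S.faceClass f (.wall w) = b ∧ (S.wallDart w l).SameEdge d)
      (S.faceWord front f) = 1 := by
  rw [S.sum_face]
  have h : ∀ i : Fin 3,
      (∑ j, wordCount (fun d => S.faceClass (.sheet i .alpha j) (.wall w) = b ∧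
          (S.wallDart w l).SameEdge d) (S.faceWord front (.sheet i .alpha j)) +
        ∑ j, wordCount (fun d => S.faceClass (.sheet i .beta j) (.wall w) = b ∧
          (S.wallDart w l).SameEdge d) (S.faceWord front (.sheet i .beta j))) +
        ∑ k, wordCount (fun d => S.faceClass (.saddle i k) (.wall w) = b ∧
          (S.wallDart w l).SameEdge d) (S.faceWord front (.saddle i k)) =
      if decide (i = w) = b then if w = i ∨ w = i + 1 then 1 else 0 else 0 := by
    intro i
    by_cases hb : decide (i = w) = b
    · rw [if_pos hb, ← S.sum_wordCount_ball i front w l]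
      exact congrArg₂ (· + ·)
        (congrArg₂ (· + ·) (Finset.sum_congr rfl fun _ _ => wordCount_and_left hb _)
          (Finset.sum_congr rfl fun _ _ => wordCount_and_left hb _))
        (Finset.sum_congr rfl fun _ _ => wordCount_and_left hb _)
    · rw [if_neg hb,
        Finset.sum_eq_zero fun _ _ => wordCount_eq_zero fun _ _ h => hb h.1,
        Finset.sum_eq_zero fun _ _ => wordCount_eq_zero fun _ _ h => hb h.1,
        Finset.sum_eq_zero fun _ _ => wordCount_eq_zero fun _ _ h => hb h.1, add_zero, add_zero]
  rw [Finset.sum_congr rfl fun i _ => h i]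
  clear h
  revert w b
  decide

theorem sameEdge_seam_iff {i i' : Fin 3} {f f' : Family} {j j' : ℕ} :
    (S.seam i f j).SameEdge (S.seam i' f' j') ↔ i = i' ∧ f = f' ∧ j = j' := by
  simp only [Dart.SameEdge, seam, Dart.reverse, Dart.mk.injEq, EdgeName.seam.injEq,
    Vertex.inner.injEq]
  constructor
  · rintro (⟨rfl, ⟨-, rfl, rfl, -⟩, -⟩ | ⟨-, ⟨-, -, -, h⟩, -⟩)
    · exact ⟨rfl, rfl, rfl⟩
    · cases h
  · rintro ⟨rfl, rfl, rfl⟩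
    simp

theorem not_sameEdge_of_name_ne {d d' : S.SDart} (h : d.name ≠ d'.name) : ¬ d.SameEdge d' := by
  rintro (rfl | rfl) <;> exact h rfl

/-- A seam of a sheet to which a saddle is attached is a side of this sheet and of one saddle. -/
theorem sum_wordCount_seam {f : Family} {j : ℕ} (hj : j < S.s) (h : ¬ S.IsFreeSheet i front j)
    (b : Bool) :
    ∑ F : S.Face, wordCount (fun d => S.faceClass F (.seam i) = b ∧ (S.seam i f j).SameEdge d)
      (S.faceWord front F) = 1 := by
  classical
  have hname : ∀ (d : S.SDart) (w : Fin 3), d.name = .wall w → ¬ (S.seam i f j).SameEdge d :=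
    fun d w hd => S.not_sameEdge_of_name_ne (by simp [seam, hd])
  have hrim : ∀ i' u v, ¬ (S.seam i f j).SameEdge (S.rim i' u v) :=
    fun i' u v => S.not_sameEdge_of_name_ne (by simp [seam, rim])
  have hfree : ∀ i' f' j', S.IsFreeSheet i' front j' →
      wordCount (S.seam i f j).SameEdge (S.sheetWord front i' f' j') = 0 := by
    intro i' f' j' h'
    rw [S.sheetWord_of_isFreeSheet i' front h', wordCount_append, ray,
      S.wordCount_arc_eq_zero i' hname, wordCount_cons, wordCount_nil, if_neg (hrim _ _ _)]
  cases b
  · rw [Finset.sum_eq_single (.saddle i ⟨_, S.sheetSaddle_lt i front hj h⟩)]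
    · refine (wordCount_and_left (by rfl) _).trans ?_
      simp only [faceWord, S.wordCount_saddleWord i front hname, wordCount_cons, wordCount_nil,
        hrim, Dart.sameEdge_reverse_right, sameEdge_seam_iff,
        S.saddleSheet_sheetSaddle i front hj]
      cases f <;> simp
    · rintro (⟨i', f', j'⟩ | ⟨i', k⟩) - hne
      · exact wordCount_eq_zero fun _ _ h => by cases h.1
      · refine (wordCount_and_left (by rfl) _).trans ?_
        simp only [faceWord, S.wordCount_saddleWord i' front hname, wordCount_cons, wordCount_nil,
          hrim, Dart.sameEdge_reverse_right, sameEdge_seam_iff]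
        have : ¬ (i = i' ∧ j = S.saddleSheet front i' k) := by
          rintro ⟨rfl, hk⟩
          refine hne (congrArg _ (Fin.ext (S.saddleSheet_injective i front k.2
            (S.sheetSaddle_lt i front hj h) ?_)))
          rw [← hk]
          exact (S.saddleSheet_sheetSaddle i front hj).symm
        simp
        tauto
    · exact fun hn => absurd (Finset.mem_univ _) hn
  · rw [Finset.sum_eq_single (.sheet i f ⟨j, hj⟩)]
    · refine (wordCount_and_left (by rfl) _).trans ?_
      simp only [faceWord, S.sheetWord_of_not_isFreeSheet i front h, wordCount_cons, wordCount_nil,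
        hrim, sameEdge_seam_iff]
      simp
    · rintro (⟨i', f', j'⟩ | ⟨i', k⟩) - hne
      · refine (wordCount_and_left (by rfl) _).trans ?_
        by_cases h' : S.IsFreeSheet i' front j'
        · exact hfree i' f' j' h'
        · simp only [faceWord, S.sheetWord_of_not_isFreeSheet i' front h', wordCount_cons,
            wordCount_nil, hrim, sameEdge_seam_iff]
          simp
          rintro rfl rfl hjj
          exact hne (congrArg _ (Fin.ext hjj.symm))
      · exact wordCount_eq_zero fun _ _ h => by cases h.1
    · exact fun hn => absurd (Finset.mem_univ _) hn

/-- A sheet that reaches the boundary of the ball is determined by each of the two end points of its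
arc, and these end points differ in kind: no arc of slope `p/q` starts where another one ends. -/
theorem sheetRim_sameEdge {i i' : Fin 3} {f f' : Family} {k k' : ℕ} (hk : k < (S.path i).x)
    (hk' : k' < (S.path i').x)
    (h : (S.rim i (S.arcEnd i (S.sideArc i f k).1 (S.sideArc i f k).2 (S.path i).q)
        (S.arcStart i (S.sideArc i f k).1 (S.sideArc i f k).2)).SameEdge
      (S.rim i' (S.arcEnd i' (S.sideArc i' f' k').1 (S.sideArc i' f' k').2 (S.path i').q)
        (S.arcStart i' (S.sideArc i' f' k').1 (S.sideArc i' f' k').2))) :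
    i = i' ∧ f = f' ∧ k = k' := by
  have hi : i' = i := by
    rcases h with h | h <;> simpa [rim, Dart.reverse] using congrArg Dart.name h
  subst hi
  have hs := S.x_add_y i'
  have ht := (S.path i').t_pos
  have htq := (S.path i').t_lt_q
  obtain ⟨h1, h2⟩ := S.sideRay_lt i' (f := f) hk
  obtain ⟨h1', h2'⟩ := S.sideRay_lt i' (f := f') hk'
  have hl := S.rayLen_sideRay i' (f := f) hk
  have hl' := S.rayLen_sideRay i' (f := f') hk'
  rw [S.sideArc_eq i' hk, S.sideArc_eq i' hk'] at h
  simp only [Dart.SameEdge, rim, Dart.reverse, Dart.mk.injEq, arcEnd, arcStart,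
    Vertex.knot.injEq] at h
  rcases h with ⟨-, -, -, h⟩ | ⟨-, -, -, h⟩
  · obtain ⟨e1, e2, -⟩ := S.ray_injective i' (k := 0) (k' := 0) h1' h1 h2' h2
      (S.rayLen_pos i' _) (S.rayLen_pos i' _) h
    refine ⟨rfl, ?_⟩
    cases f <;> cases f' <;> simp only [sideRay] at e1 e2
    · exact ⟨rfl, by omega⟩
    · omega
    · omega
    · exact ⟨rfl, by omega⟩
  · rw [Nat.add_sub_assoc (by omega)] at h
    obtain ⟨-, -, e3⟩ := S.ray_injective i' (k := 0) (k' := (S.path i').q - 1) h1' h1 h2' h2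
      (S.rayLen_pos i' _) (by omega) h
    omega

/-- The three kinds of edges on the boundary of the neighbourhood of the knot. -/
theorem exists_of_rim_mem_faceWord {F : S.Face} {u v : Vertex S.axisCount}
    (hd : S.rim i u v ∈ S.faceWord front F) :
    (∃ f j, F = .sheet i f j ∧ S.IsFreeSheet i front j ∧
      u = S.arcEnd i (S.sideArc i f (j - front i)).1 (S.sideArc i f (j - front i)).2 (S.path i).q ∧
      v = S.arcStart i (S.sideArc i f (j - front i)).1 (S.sideArc i f (j - front i)).2) ∨
    (∃ f j, F = .sheet i f j ∧ ¬ S.IsFreeSheet i front j ∧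
      u = .inner i f j true ∧ v = .inner i f j false) ∨
    (∃ k f b w l, F = .saddle i k ∧
      ((u = .inner i f (S.saddleSheet front i k) b ∧ v = .knot w l) ∨
        (u = .knot w l ∧ v = .inner i f (S.saddleSheet front i k) b))) := by
  rcases F with ⟨i', f, j⟩ | ⟨i', k⟩
  · simp only [faceWord] at hd
    by_cases h : S.IsFreeSheet i' front j
    · rw [S.sheetWord_of_isFreeSheet i' front h, List.mem_append, List.mem_singleton] at hd
      rcases hd with hd | hd
      · obtain ⟨k, hk⟩ := S.name_of_mem_arc i' hd
        simp [rim] at hk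
      · simp only [rim, Dart.mk.injEq, EdgeName.rim.injEq] at hd
        obtain ⟨rfl, rfl, rfl⟩ := hd
        exact Or.inl ⟨f, j, rfl, h, rfl, rfl⟩
    · rw [S.sheetWord_of_not_isFreeSheet i' front h] at hd
      simp only [List.mem_cons, List.not_mem_nil, or_false] at hd
      rcases hd with hd | hd
      · simp [rim, seam] at hd
      · simp only [rim, Dart.mk.injEq, EdgeName.rim.injEq] at hd
        obtain ⟨rfl, rfl, rfl⟩ := hd
        exact Or.inr (Or.inl ⟨f, j, rfl, h, rfl, rfl⟩)
  · simp only [faceWord] at hd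
    right; right
    rcases S.mem_saddleWord i' front k.2 hd with hd | hd | hd | hd | ⟨f, b, w, l, hd⟩ |
      ⟨f, b, w, l, hd⟩
    · obtain ⟨k, hk⟩ := S.name_of_mem_arc i' hd
      simp [rim] at hk
    · obtain ⟨k, hk⟩ := S.name_of_mem_arc i' hd
      simp [rim, Dart.reverse] at hk
    · simp [rim, seam] at hd
    · simp [rim, seam, Dart.reverse] at hd
    · simp only [rim, Dart.mk.injEq, EdgeName.rim.injEq] at hd
      obtain ⟨rfl, rfl, rfl⟩ := hd
      exact ⟨k, f, b, w, l, rfl, Or.inl ⟨rfl, rfl⟩⟩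
    · simp only [rim, Dart.mk.injEq, EdgeName.rim.injEq] at hd
      obtain ⟨rfl, rfl, rfl⟩ := hd
      exact ⟨k, f, b, w, l, rfl, Or.inr ⟨rfl, rfl⟩⟩

/-- Faces that share an edge on the boundary of the neighbourhood of the knot are equal. -/
theorem face_eq_of_rim {F F' : S.Face} {u v u' v' : Vertex S.axisCount}
    (hd : S.rim i u v ∈ S.faceWord front F) (hd' : S.rim i u' v' ∈ S.faceWord front F')
    (h : (S.rim i u v).SameEdge (S.rim i u' v')) : F' = F := by
  have huv : u' = u ∧ v' = v ∨ u' = v ∧ v' = u := by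
    simpa [Dart.SameEdge, rim, Dart.reverse] using h
  rcases S.exists_of_rim_mem_faceWord i front hd with
    ⟨f, j, rfl, hj, rfl, rfl⟩ | ⟨f, j, rfl, hj, rfl, rfl⟩ | ⟨k, f, b, w, l, rfl, hk⟩ <;>
  rcases S.exists_of_rim_mem_faceWord i front hd' with
    ⟨f', j', rfl, hj', rfl, rfl⟩ | ⟨f', j', rfl, hj', rfl, rfl⟩ | ⟨k', f', b', w', l', rfl, hk'⟩
  · unfold IsFreeSheet at hj hj'
    obtain ⟨-, rfl, hjj⟩ := S.sheetRim_sameEdge (by omega) (by omega) h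
    rw [show j' = j from Fin.ext (by omega)]
  · simp [arcEnd, arcStart] at huv
  · rcases hk' with ⟨rfl, rfl⟩ | ⟨rfl, rfl⟩ <;> simp [arcEnd, arcStart] at huv
  · simp [arcEnd, arcStart] at huv
  · simp only [Vertex.inner.injEq, reduceCtorEq, and_false, or_false, and_true, true_and] at huv
    obtain ⟨⟨rfl, hjj⟩, -⟩ := huv
    rw [show j' = j from Fin.ext hjj]
  · rcases hk' with ⟨rfl, rfl⟩ | ⟨rfl, rfl⟩ <;> simp at huv
  · rcases hk with ⟨rfl, rfl⟩ | ⟨rfl, rfl⟩ <;> simp [arcEnd, arcStart] at huv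
  · rcases hk with ⟨rfl, rfl⟩ | ⟨rfl, rfl⟩ <;> simp at huv
  · have hkk : S.saddleSheet front i k' = S.saddleSheet front i k := by
      rcases hk with ⟨rfl, rfl⟩ | ⟨rfl, rfl⟩ <;> rcases hk' with ⟨rfl, rfl⟩ | ⟨rfl, rfl⟩ <;>
        simp only [Vertex.inner.injEq, reduceCtorEq, and_false, or_false, false_or, true_and] at huv <;>
        tauto
    rw [show k' = k from Fin.ext (S.saddleSheet_injective i front k'.2 k.2 hkk)]

/-- Every edge on the boundary of the neighbourhood of the knot is a side of exactly one face. -/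
theorem sum_wordCount_rim {F : S.Face} {u v : Vertex S.axisCount}
    (hd : S.rim i u v ∈ S.faceWord front F) :
    ∑ F' : S.Face, wordCount (S.rim i u v).SameEdge (S.faceWord front F') = 1 := by
  classical
  have hname : ∀ (d : S.SDart) (w : Fin 3), d.name = .wall w → ¬ (S.rim i u v).SameEdge d :=
    fun d w hd => S.not_sameEdge_of_name_ne (by simp [rim, hd])
  have hseam : ∀ i' f' j', ¬ (S.rim i u v).SameEdge (S.seam i' f' j') :=
    fun i' u v => S.not_sameEdge_of_name_ne (by simp [seam, rim])
  have hfree : ∀ i' f' j', S.IsFreeSheet i' front j' →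
      wordCount (S.rim i u v).SameEdge (S.sheetWord front i' f' j') =
      if (S.rim i u v).SameEdge (S.rim i'
        (S.arcEnd i' (S.sideArc i' f' (j' - front i')).1 (S.sideArc i' f' (j' - front i')).2
          (S.path i').q)
        (S.arcStart i' (S.sideArc i' f' (j' - front i')).1 (S.sideArc i' f' (j' - front i')).2))
      then 1 else 0 := by
    intro i' f' j' h'
    rw [S.sheetWord_of_isFreeSheet i' front h', wordCount_append, ray,
      S.wordCount_arc_eq_zero i' hname, wordCount_cons, wordCount_nil]
    simp
  have hattached : ∀ i' f' j', ¬ S.IsFreeSheet i' front j' →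
      wordCount (S.rim i u v).SameEdge (S.sheetWord front i' f' j') =
      if (S.rim i u v).SameEdge (S.rim i' (.inner i' f' j' true) (.inner i' f' j' false))
      then 1 else 0 := by
    intro i' f' j' h'
    rw [S.sheetWord_of_not_isFreeSheet i' front h', wordCount_cons, wordCount_cons, wordCount_nil,
      if_neg (hseam _ _ _)]
    simp
  have hsaddle : ∀ i' k', wordCount (S.rim i u v).SameEdge (S.saddleWord front i' k') = _ :=
    fun i' k' => S.wordCount_saddleWord i' front hname k'
  rw [Finset.sum_eq_single F]
  · rcases F with ⟨i', f', j'⟩ | ⟨i', k'⟩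
    · simp only [faceWord] at hd ⊢
      by_cases h' : S.IsFreeSheet i' front j'
      · rw [hfree i' f' j' h', if_pos]
        rw [S.sheetWord_of_isFreeSheet i' front h', List.mem_append, List.mem_singleton] at hd
        rcases hd with hd | hd
        · obtain ⟨k, hk⟩ := S.name_of_mem_arc i' hd
          simp [rim] at hk
        · exact Or.inl hd.symm
      · rw [hattached i' f' j' h', if_pos]
        rw [S.sheetWord_of_not_isFreeSheet i' front h'] at hd
        simp only [List.mem_cons, List.not_mem_nil, or_false] at hd
        rcases hd with hd | hd
        · simp [rim, seam] at hd
        · exact Or.inl hd.symm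
    · simp only [faceWord] at hd ⊢
      rw [hsaddle]
      simp only [saddleWord, List.mem_append, List.mem_cons, List.not_mem_nil, or_false,
        List.mem_reverse, List.mem_map, arcStart, arcEnd] at hd
      rcases hd with ((((hd | hd) | hd) | (hd | hd | hd)) | ⟨d, hd, hd'⟩) | hd
      · simp [rim, seam] at hd
      · obtain ⟨rfl, rfl, rfl⟩ : i = i' ∧ u = _ ∧ v = _ := by simpa [rim] using hd
        simp [wordCount_cons, wordCount_nil, Dart.SameEdge, Dart.reverse, rim, seam, arcStart,
          arcEnd]
      · obtain ⟨k, hk⟩ := S.name_of_mem_arc i' hd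
        simp [rim] at hk
      · obtain ⟨rfl, rfl, rfl⟩ : i = i' ∧ u = _ ∧ v = _ := by simpa [rim] using hd
        simp [wordCount_cons, wordCount_nil, Dart.SameEdge, Dart.reverse, rim, seam, arcStart,
          arcEnd]
      · simp [rim, seam, Dart.reverse] at hd
      · obtain ⟨rfl, rfl, rfl⟩ : i = i' ∧ u = _ ∧ v = _ := by simpa [rim] using hd
        simp [wordCount_cons, wordCount_nil, Dart.SameEdge, Dart.reverse, rim, seam, arcStart,
          arcEnd]
      · obtain ⟨k, hk⟩ := S.name_of_mem_arc i' hd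
        have hn : d.name = .rim i := congrArg Dart.name hd'
        rw [hn] at hk
        cases hk
      · obtain ⟨rfl, rfl, rfl⟩ : i = i' ∧ u = _ ∧ v = _ := by simpa [rim] using hd
        simp [wordCount_cons, wordCount_nil, Dart.SameEdge, Dart.reverse, rim, seam, arcStart,
          arcEnd]
  · intro F' _ hne
    refine wordCount_eq_zero fun d hd' hs => hne ?_
    obtain ⟨u', v', rfl⟩ : ∃ u' v', d = S.rim i u' v' := by
      rcases hs with rfl | rfl
      exacts [⟨u, v, rfl⟩, ⟨v, u, rfl⟩]
    exact S.face_eq_of_rim i front hd hd' hs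
  · exact fun hn => absurd (Finset.mem_univ _) hn

/-! ### Orienting the faces -/

/-- The sign of a point of the axis: the direction, from the left wall of a ball to its right wall or
back, in which the oriented surface crosses the axis there. As the number of points is even, the
sign is well defined on `ℤ / N`. -/
def axisSign (l : ZMod S.axisCount) : ℤˣ := (l.cast : ℤ).negOnePow

theorem axisSign_intCast (z : ℤ) : S.axisSign (z : ZMod S.axisCount) = z.negOnePow := by
  rw [axisSign, ZMod.coe_intCast, Int.negOnePow_eq_iff]
  have h : (2 : ℤ) ∣ S.axisCount := ⟨S.s + S.b, by unfold axisCount; push_cast; ring⟩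
  obtain ⟨c, hc⟩ := h
  rw [Int.emod_def, hc]
  exact ⟨-(c * (z / (2 * c))), by ring⟩

theorem axisSign_axisPoint (hs : Even S.s) (ℓ : ℤ) (m : ℕ) : S.axisSign (S.axisPoint i ℓ m) =
    if Even m then (ℓ + S.offset i).negOnePow else - (ℓ + S.offset i).negOnePow := by
  by_cases hm : Even m
  · rw [if_pos hm, S.axisPoint_even hm, axisSign_intCast, Int.negOnePow_eq_iff]
    obtain ⟨a, rfl⟩ := hm
    exact ⟨a * (S.path i).coordC, by push_cast; ring⟩
  · rw [if_neg hm, S.axisPoint_odd hm, axisSign_intCast, ← Int.negOnePow_succ,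
      Int.negOnePow_eq_iff]
    obtain ⟨a, rfl⟩ := Nat.not_even_iff_odd.1 hm
    obtain ⟨c, hc⟩ := hs
    refine ⟨c - 1 - ℓ - (a + 1) * (S.path i).coordC, ?_⟩
    push_cast [hc]
    ring

/-- Since the number of sheets is even, the two ends of an arc that returns to the axis have opposite
signs. -/
theorem axisSign_sub (hs : Even S.s) (o : ℤ) (l : ZMod S.axisCount) :
    S.axisSign (((S.s - 1 + 2 * o : ℤ) : ZMod S.axisCount) - l) = - S.axisSign l := by
  obtain ⟨z, rfl⟩ := ZMod.intCast_surjective l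
  rw [← Int.cast_sub, axisSign_intCast, axisSign_intCast, ← Int.negOnePow_succ,
    Int.negOnePow_eq_iff]
  obtain ⟨c, hc⟩ := hs
  exact ⟨c - 1 + o - z, by rw [hc]; push_cast; ring⟩

/-- The orientation, relative to the direction from left to right, of a face whose boundary contains
the final arc `(ε, κ)`. -/
def raySign (ε κ : ℕ) : ℤˣ := - (S.rayLine i ε κ + S.offset i).negOnePow

/-- The bottom arc and the top arc of a saddle have opposite signs. -/
theorem raySign_bottom {k : ℕ} (hk : k < (S.path i).y) :
    S.raySign i 0 ((S.path i).y - 1 - k) = - S.raySign i 1 k := by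
  rw [raySign, raySign, neg_neg, ← Int.negOnePow_succ, Int.negOnePow_eq_iff]
  have h : (((S.path i).y - 1 - k : ℕ) : ℤ) = (S.path i).y - 1 - k := by omega
  rw [rayLine, rayLine, if_pos hk, if_pos (by omega), h]
  exact ⟨-k, by push_cast; ring⟩

/-- The orientation of a sheet. A sheet to which a saddle is attached is oriented by the saddle. -/
def sheetSign (f : Family) (j : ℕ) : ℤˣ :=
  if (front i : ℕ) ≤ j ∧ j < front i + (S.path i).x then
    S.raySign i (S.sideRay i f (j - front i)).1 (S.sideRay i f (j - front i)).2
  else match f with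
    | .alpha => - S.raySign i 1 (S.sheetSaddle i front j)
    | .beta => S.raySign i 1 (S.sheetSaddle i front j)

/-- The orientation of a face. -/
def faceSign : S.Face → ℤˣ
  | .sheet i f j => S.sheetSign i front f j
  | .saddle i k => S.raySign i 1 k

/-- The direction of the glued edges that the faces of the first class follow: an arc in a wall is
directed by the sign of its end points on the axis, a seam by the orientation of the sheet. The value
at the edges on the boundary of the neighbourhood of the knot is irrelevant. -/
def dartSign (d : S.SDart) : ℤˣ :=
  match d.src, d.tgt with
  | .axis l, _ => S.axisSign l
  | _, .axis l => - S.axisSign l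
  | .inner i f j false, _ => S.sheetSign i front f j
  | .inner i f j true, _ => - S.sheetSign i front f j
  | _, _ => 1

theorem dartSign_wallDart (w : Fin 3) (l : ZMod S.axisCount) :
    S.dartSign front (S.wallDart w l) = S.axisSign l := rfl

theorem dartSign_wallDart_reverse (hs : Even S.s) (w : Fin 3) (l : ZMod S.axisCount) :
    S.dartSign front (S.wallDart w l).reverse = - S.axisSign l := by
  unfold wallDart Dart.reverse dartSign
  by_cases h : S.IsKnotEnd w l
  · simp only [if_pos h]
  · simp only [if_neg h]
    exact S.axisSign_sub hs _ l

theorem dartSign_seam (f : Family) (j : ℕ) :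
    S.dartSign front (S.seam i f j) = S.sheetSign i front f j := rfl

theorem dartSign_seam_reverse (f : Family) (j : ℕ) :
    S.dartSign front (S.seam i f j).reverse = - S.sheetSign i front f j := rfl

/-- The sides along a final arc, traversed from left to right, follow the direction of the edges in
the left wall and oppose it in the right wall, or conversely. -/
theorem raySign_eq (hs : Even S.s) {ε κ : ℕ} (hκ : κ < S.s) {d : S.SDart} (hd : d ∈ S.ray i ε κ) :
    ∃ w, d.name = .wall w ∧
      S.raySign i ε κ = if i = w then S.dartSign front d else - S.dartSign front d := by
  obtain ⟨k, hk, rfl⟩ := (S.mem_ray i).1 hd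
  refine ⟨wallOf i (S.rayCol i ε κ + k), rfl, ?_⟩
  have hw := wallOf_eq_iff i (S.rayCol i ε κ + k)
  rw [eq_comm] at hw
  rcases hk.lt_or_eq with hk | hk
  · rw [S.rayDart_eq_reverse i hκ hk, dartSign_wallDart_reverse _ _ hs, S.axisSign_axisPoint i hs,
      raySign]
    by_cases h : Even (S.rayCol i ε κ + k)
    · rw [if_pos (hw.2 h), if_pos h]
    · rw [if_neg fun hc => h (hw.1 hc), if_neg h, neg_neg]
  · obtain ⟨k', rfl⟩ : ∃ k', k = k' + 1 := ⟨k - 1, by have := S.rayLen_pos i κ; omega⟩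
    rw [S.rayDart_succ_eq i hκ (by omega), dartSign_wallDart, S.axisSign_axisPoint i hs, raySign]
    have h' : Even (S.rayCol i ε κ + (k' + 1)) ↔ ¬ Even (S.rayCol i ε κ + k') := by
      rw [← Nat.add_assoc, Nat.even_add_one]
    by_cases h : Even (S.rayCol i ε κ + k')
    · rw [if_neg (fun hc => h'.1 (hw.1 hc) h), if_pos h]
    · rw [if_pos (hw.2 (h'.2 h)), if_neg h]

/-- Every side of a face lies on an arc in a wall, on the seam of a sheet to which a saddle is
attached, or on the boundary of the neighbourhood of the knot. -/
theorem exists_of_mem_faceWord {F : S.Face} {d : S.SDart} (hd : d ∈ S.faceWord front F) :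
    (∃ w l, d = S.wallDart w l ∨ d = (S.wallDart w l).reverse) ∨
    (∃ i f j, j < S.s ∧ ¬ S.IsFreeSheet i front j ∧
      (d = S.seam i f j ∨ d = (S.seam i f j).reverse)) ∨
    (∃ i u v, d = S.rim i u v) := by
  rcases F with ⟨i, f, j⟩ | ⟨i, k⟩
  · simp only [faceWord] at hd
    by_cases h : S.IsFreeSheet i front j
    · rw [S.sheetWord_of_isFreeSheet i front h, List.mem_append, List.mem_singleton] at hd
      unfold IsFreeSheet at h
      rcases hd with hd | rfl
      · exact Or.inl (S.exists_sameEdge_of_mem_ray i (S.sideRay_lt i (by omega)).2 hd)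
      · exact Or.inr (Or.inr ⟨_, _, _, rfl⟩)
    · rw [S.sheetWord_of_not_isFreeSheet i front h] at hd
      simp only [List.mem_cons, List.not_mem_nil, or_false] at hd
      rcases hd with rfl | rfl
      · exact Or.inr (Or.inl ⟨i, f, j, j.2, h, Or.inl rfl⟩)
      · exact Or.inr (Or.inr ⟨_, _, _, rfl⟩)
  · have hs := S.x_add_y i
    have hk := k.2
    have hj := S.saddleSheet_lt i front hk
    have hj' := S.not_isFreeSheet_saddleSheet i front hk
    rcases S.mem_saddleWord i front hk hd with hd | hd | rfl | rfl | ⟨f, b, w, l, rfl⟩ |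
      ⟨f, b, w, l, rfl⟩
    · exact Or.inl (S.exists_sameEdge_of_mem_ray i (by omega) hd)
    · obtain ⟨w, l, h⟩ := S.exists_sameEdge_of_mem_ray i (by omega) hd
      refine Or.inl ⟨w, l, ?_⟩
      rw [← Dart.reverse_reverse d]
      rcases h with h | h <;> rw [h]
      · exact Or.inr rfl
      · exact Or.inl rfl
    · exact Or.inr (Or.inl ⟨i, _, _, hj, hj', Or.inl rfl⟩)
    · exact Or.inr (Or.inl ⟨i, _, _, hj, hj', Or.inr rfl⟩)
    · exact Or.inr (Or.inr ⟨_, _, _, rfl⟩)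
    · exact Or.inr (Or.inr ⟨_, _, _, rfl⟩)

theorem dartSign_reverse (hs : Even S.s) {F : S.Face} {d : S.SDart} (hd : d ∈ S.faceWord front F)
    (hn : ¬ ∃ i, d.name = .rim i) : S.dartSign front d.reverse = - S.dartSign front d := by
  rcases S.exists_of_mem_faceWord front hd with ⟨w, l, rfl | rfl⟩ | ⟨i, f, j, -, -, rfl | rfl⟩ |
    ⟨i, u, v, rfl⟩
  · rw [dartSign_wallDart_reverse _ _ hs, dartSign_wallDart]
  · rw [dartSign_wallDart_reverse _ _ hs, Dart.reverse_reverse, dartSign_wallDart, neg_neg]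
  · rfl
  · rw [Dart.reverse_reverse, dartSign_seam_reverse, dartSign_seam, neg_neg]
  · exact absurd ⟨i, rfl⟩ hn

theorem sheetSign_saddleSheet {f : Family} {k : ℕ} (hk : k < (S.path i).y) :
    S.sheetSign i front f (S.saddleSheet front i k) = match f with
    | .alpha => - S.raySign i 1 k
    | .beta => S.raySign i 1 k := by
  have hj := S.saddleSheet_lt i front hk
  have hj' := S.not_isFreeSheet_saddleSheet i front hk
  have h : S.sheetSaddle i front (S.saddleSheet front i k) = k :=
    S.saddleSheet_injective i front (S.sheetSaddle_lt i front hj hj') hk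
      (S.saddleSheet_sheetSaddle i front hj)
  refine (if_neg hj').trans ?_
  rw [h]

/-- With the chosen orientations, the faces of the first class follow the directions of the glued edges
and those of the second class oppose them. -/
theorem faceSign_eq (hs : Even S.s) {F : S.Face} {d : S.SDart} (hd : d ∈ S.faceWord front F)
    (hn : ¬ ∃ i, d.name = .rim i) : S.faceSign front F =
      if S.faceClass F d.name then S.dartSign front d else - S.dartSign front d := by
  rcases F with ⟨i, f, j⟩ | ⟨i, k⟩
  · simp only [faceWord] at hd
    by_cases h : S.IsFreeSheet i front j
    · rw [S.sheetWord_of_isFreeSheet i front h, List.mem_append, List.mem_singleton] at hd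
      rcases hd with hd | rfl
      · have hf : S.faceSign front (.sheet i f j) = _ := if_pos h
        unfold IsFreeSheet at h
        obtain ⟨w, hw, hsign⟩ := S.raySign_eq i front hs (S.sideRay_lt i (by omega)).2 hd
        rw [hf, hw, hsign]
        by_cases h : i = w <;> simp [faceClass, faceBall, h]
      · exact absurd ⟨i, rfl⟩ hn
    · rw [S.sheetWord_of_not_isFreeSheet i front h] at hd
      simp only [List.mem_cons, List.not_mem_nil, or_false] at hd
      rcases hd with rfl | rfl
      · rfl
      · exact absurd ⟨i, rfl⟩ hn
  · have hxy := S.x_add_y i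
    have hk := k.2
    have hf : S.faceSign front (.saddle i k) = S.raySign i 1 k := rfl
    rcases S.mem_saddleWord i front hk hd with hd' | hd' | rfl | rfl | ⟨f, b, w, l, rfl⟩ |
      ⟨f, b, w, l, rfl⟩
    · obtain ⟨w, hw, hsign⟩ := S.raySign_eq i front hs (by omega) hd'
      rw [hf, hw, hsign]
      by_cases h : i = w <;> simp [faceClass, faceBall, h]
    · obtain ⟨w, hw, hsign⟩ := S.raySign_eq i front hs (by omega) hd'
      rw [S.raySign_bottom i hk, S.dartSign_reverse front hs hd hn] at hsign
      have hw' : d.name = .wall w := hw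
      rw [hf, hw', ← neg_neg (S.raySign i 1 k), hsign]
      by_cases h : i = w <;> simp [faceClass, faceBall, h]
    · rw [dartSign_seam, S.sheetSign_saddleSheet i front hk, hf]
      simp [faceClass, seam]
    · rw [dartSign_seam_reverse, S.sheetSign_saddleSheet i front hk, hf]
      simp [faceClass, seam, Dart.reverse]
    · exact absurd ⟨i, rfl⟩ hn
    · exact absurd ⟨i, rfl⟩ hn

/-! ### The candidate surface -/

theorem sum_wordCount_of_class {F : S.Face} {d : S.SDart} (hd : d ∈ S.faceWord front F)
    (hn : ¬ ∃ i, d.name = .rim i) (b : Bool) :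
    ∑ F' : S.Face, wordCount (fun d' => S.faceClass F' d.name = b ∧ d.SameEdge d')
      (S.faceWord front F') = 1 := by
  rcases S.exists_of_mem_faceWord front hd with ⟨w, l, rfl | rfl⟩ | ⟨i, f, j, hj, hj', rfl | rfl⟩ |
    ⟨i, u, v, rfl⟩
  · exact S.sum_wordCount_wallDart front w l b
  · simp only [Dart.sameEdge_reverse_left]
    exact S.sum_wordCount_wallDart front w l b
  · exact S.sum_wordCount_seam i front hj hj' b
  · simp only [Dart.sameEdge_reverse_left]
    exact S.sum_wordCount_seam i front hj hj' b
  · exact absurd ⟨i, rfl⟩ hn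

theorem sum_wordCount_of_free {F : S.Face} {d : S.SDart} (hd : d ∈ S.faceWord front F)
    (hf : ∃ i, d.name = .rim i) :
    ∑ F' : S.Face, wordCount d.SameEdge (S.faceWord front F') = 1 := by
  obtain ⟨i, hi⟩ := hf
  obtain ⟨n, u, v⟩ := d
  obtain rfl : n = .rim i := hi
  exact S.sum_wordCount_rim i front hd

theorem existsUnique_side_of_class (e : (S.candidateSurface front).Side)
    (hn : ¬ (S.candidateSurface front).Free e.dart.name) (b : Bool) :
    ∃! e' : (S.candidateSurface front).Side,
      S.faceClass e'.1 e.dart.name = b ∧ e.dart.SameEdge e'.dart :=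
  existsUnique_position (S.faceWord front)
    (fun F d => S.faceClass F e.dart.name = b ∧ e.dart.SameEdge d)
    (S.sum_wordCount_of_class front (List.get_mem _ _) hn b)

theorem existsUnique_side_of_free (e : (S.candidateSurface front).Side)
    (hf : (S.candidateSurface front).Free e.dart.name) :
    ∃! e' : (S.candidateSurface front).Side, e.dart.SameEdge e'.dart :=
  existsUnique_position (S.faceWord front) (fun _ d => e.dart.SameEdge d)
    (S.sum_wordCount_of_free front (List.get_mem _ _) hf)

theorem candidateSurface_isSurface : (S.candidateSurface front).IsSurface :=
  PolygonalComplex.isSurface_of_classes S.faceClass (S.existsUnique_side_of_class front)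
    (S.existsUnique_side_of_free front)

theorem candidateSurface_isOrientable (hs : Even S.s) : (S.candidateSurface front).IsOrientable :=
  PolygonalComplex.isOrientable_of_classes S.faceClass (S.existsUnique_side_of_class front)
    (S.existsUnique_side_of_free front) (S.faceSign front) (S.dartSign front)
    (fun _ hn => S.dartSign_reverse front hs (List.get_mem _ _) hn)
    (fun _ hn => S.faceSign_eq front hs (List.get_mem _ _) hn)

end EdgepathSystem

theorem mainTheorem5 (p q : ℕ) (hp_odd : Odd p) (hq_odd : Odd q)
    (hp : 3 ≤ p) (hq : (p - 1) ^ 2 - (p - 1) + 1 ≤ q)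
    (hg : Even (Nat.gcd (p - 1) (q - 1)))
    (hs : Even (((p - 1) + (q - 1)) / Nat.gcd (p - 1) (q - 1)))
    (front : (pretzelSystem p q hp hq).SaddleChoice) :
    ((pretzelSystem p q hp hq).candidateSurface front).IsSurface ∧
      ((pretzelSystem p q hp hq).candidateSurface front).IsOrientable :=
  ⟨EdgepathSystem.candidateSurface_isSurface _ front,
    EdgepathSystem.candidateSurface_isOrientable _ front hs⟩
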